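/- Let $p$ be a prime and let $F$ be a nonarchimedean local field of residue characteristic $p$, with valuation $\nu_F$. Let $D$ be a central division algebra over $F$ with $\dim_F D=d^2$ and $d>4$. If $F$ has characteristic $0$, let $e$ be the ramification index of $F$ over $\mathbb{Q}_p$ and assume $p>de+1$; if $F$ has characteristic $p$, assume $\gcd(p,d)=1$. Put $\nu_D=\frac1d\,\nu_F\circ\mathrm{Nrd}$, let $\mathcal{O}_D=\{x\in D:\nu_D(x)\ge 0\}$ be the ring of integers of $D$, let $\varpi$ be a uniformizer of $D$ (so that $\{x\in D:\nu_D(x)>0\}=\varpi\mathcal{O}_D$), and let $k_D=\mathcal{O}_D/\varpi\mathcal{O}_D$ be the residue field. For $i\ge 1$ put $I_i=1+\varpi^i\mathcal{O}_D\subset D^\times$, and let $q_i\colon I_i\to I_i/I_{i+1}\cong k_D$ be the map $1+u\varpi^i\mapsto u \bmod \varpi\mathcal{O}_D$ ($u\in\mathcal{O}_D$). Write $[x,y]=xyx^{-1}y^{-1}$ for $x,y\in D^\times$, and let $[I_1,I_1]I_1^p$ be the closed subgroup of $D^\times$ generated by all commutators $[x,y]$ and all $p$-th powers $z^p$ with $x,y,z\in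 I_1$. Then: (1) Let $[\cdot]\colon k_D\to\mathcal{O}_D$ be a Teichmüller lift, that is, a multiplicative section of the reduction map $\mathcal{O}_D\to k_D$ with $[0]=0$ and $[1]=1$. For every $\alpha\in k_D^\times$ there are $a,b\in k_D$ such that $1+[a]\varpi\ne 1$, $1+[b]\varpi\neq 1$, $$q_2\bigl(\bigl[\,1+[a]\varpi,\;1+[b]\varpi\,\bigr]\bigr)=\alpha,$$ and $a/b$ does not lie in any proper subfield of $k_D$. (2) Every element $g\in [I_1,I_1]I_1^p$ with $g\notin I_3$ can be written as $g=[x,y]\,z^p$ with $x,y,z\in I_1$. -/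

import Mathlib

open ValuativeRel

noncomputable section

namespace LocalDivisionAlgebra

theorem exists_field_adjoin.{v, u} {F : Type v} {D : Type u} [Field F] [DivisionRing D] [Algebra F D]
    [FiniteDimensional F D] (x : D) :
    ∃ (K : Type u) (_ : Field K) (_ : Algebra F K) (_ : FiniteDimensional F K) (f : K →ₐ[F] D)
      (z : K), f z = x ∧ Algebra.adjoin F {z} = ⊤ := by
  have hc : IsMulCommutative (Algebra.adjoin F {x}) :=
    Algebra.isMulCommutative_adjoin F (by rintro a rfl b rfl; rfl)
  let : CommRing (Algebra.adjoin F {x}) :=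
    { (inferInstance : Ring (Algebra.adjoin F {x})) with
      mul_comm := fun a b => hc.is_comm.comm a b }
  let : Field (Algebra.adjoin F {x}) := fieldOfFiniteDimensional F _
  refine ⟨Algebra.adjoin F {x}, inferInstance, inferInstance, inferInstance,
    (Algebra.adjoin F {x}).val, ⟨x, Algebra.self_mem_adjoin_singleton F x⟩, rfl, ?_⟩
  apply Subalgebra.map_injective (f := (Algebra.adjoin F {x}).val) Subtype.val_injective
  rw [AlgHom.map_adjoin, Set.image_singleton, Algebra.map_top, Subalgebra.range_val]
  rfl

theorem exists_norm_eq {F D : Type*} [Field F] [DivisionRing D] [Algebra F D]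
    [FiniteDimensional F D] (x : D) :
    ∃ n : ℕ, n ≠ 0 ∧ ∃ s : ℕ, Algebra.norm F x = ((-1) ^ s * (minpoly F x).coeff 0) ^ n := by
  obtain ⟨K, _, _, _, f, z, rfl, hz⟩ := exists_field_adjoin (F := F) x
  let : Module K D := Module.compHom D f.toRingHom
  have hsm : ∀ (k : K) (y : D), k • y = f k * y := fun _ _ => rfl
  have : IsScalarTower F K D := ⟨fun a k y => by
    rw [hsm, hsm, map_smul, smul_mul_assoc]⟩
  have : FiniteDimensional K D := FiniteDimensional.right F K D
  refine ⟨Module.finrank K D, Module.finrank_pos.ne', (minpoly F z).natDegree, ?_⟩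
  have h1 : Algebra.norm F (f z) = Algebra.norm F z ^ Module.finrank K D := by
    have h := LinearMap.det_restrictScalars (R := F) (S := K) (A := D)
      (f := z • LinearMap.id)
    rw [LinearMap.det_smul, LinearMap.det_id, mul_one, map_pow] at h
    rw [← h, Algebra.norm_apply]
    congr 1
  have h2 := Algebra.PowerBasis.norm_gen_eq_coeff_zero_minpoly
    (PowerBasis.ofAdjoinEqTop (Algebra.IsIntegral.isIntegral (R := F) z) hz)
  rw [PowerBasis.ofAdjoinEqTop_gen, PowerBasis.ofAdjoinEqTop_dim] at h2
  rw [h1, h2, minpoly.algHom_eq f f.injective]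

theorem valuation_norm_one_add_le {F D : Type*} [Field F] [ValuativeRel F] [TopologicalSpace F]
    [IsNonarchimedeanLocalField F] [DivisionRing D] [Algebra F D] [FiniteDimensional F D] {x : D}
    (hx : valuation F (Algebra.norm F x) ≤ 1) : valuation F (Algebra.norm F (1 + x)) ≤ 1 := by
  have key : ∀ y : D, valuation F (Algebra.norm F y) ≤ 1 ↔
      valuation F ((minpoly F y).coeff 0) ≤ 1 := by
    intro y
    obtain ⟨n, hn, s, h⟩ := exists_norm_eq (F := F) y
    rw [h, map_pow, map_mul, map_pow, Valuation.map_neg, map_one, one_pow, one_mul]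
    exact pow_le_one_iff hn
  rw [key] at hx ⊢
  obtain ⟨K, _, _, _, f, z, rfl, -⟩ := exists_field_adjoin (F := F) x
  rw [show 1 + f z = f (1 + z) by simp, minpoly.algHom_eq f f.injective]
  rw [minpoly.algHom_eq f f.injective] at hx
  let := IsTopologicalAddGroup.rightUniformSpace F
  have := isUniformAddGroup_of_addCommGroup (G := F)
  let : (Valued.v (R := F)).RankOne :=
  { hom' := IsRankLeOne.nonempty.some.emb (R := F).comp MonoidWithZeroHom.ValueGroup₀.embedding
    strictMono' := IsRankLeOne.nonempty.some.strictMono.comp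
        MonoidWithZeroHom.ValueGroup₀.embedding_strictMono }
  let : NontriviallyNormedField F := Valued.toNontriviallyNormedField F (ValueGroupWithZero F)
  have : CompleteSpace F := inferInstanceAs (CompleteSpace F)
  have hn : ∀ a : F, ‖a‖ ≤ 1 ↔ valuation F a ≤ 1 := fun a =>
    Valued.toNormedField.norm_le_one_iff
  have hs : ∀ w : K, spectralNorm F K w ≤ 1 ↔ valuation F ((minpoly F w).coeff 0) ≤ 1 := by
    intro w
    have hd : (0 : ℝ) < 1 / (minpoly F w).natDegree := by
      have := minpoly.natDegree_pos (Algebra.IsIntegral.isIntegral (R := F) w)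
      positivity
    rw [spectralNorm.spectralNorm_eq_norm_coeff_zero_rpow, ← hn]
    constructor
    · intro h
      by_contra! h'
      exact absurd h (not_le.2 (Real.one_lt_rpow h' hd))
    · exact fun h => Real.rpow_le_one (norm_nonneg _) h hd.le
  rw [← hs] at hx ⊢
  refine (isNonarchimedean_spectralNorm 1 z).trans (max_le ?_ hx)
  rw [spectralNorm_one]

theorem valuation_norm_neg {F D : Type*} [Field F] [ValuativeRel F] [DivisionRing D] [Algebra F D]
    (x : D) : valuation F (Algebra.norm F (-x)) = valuation F (Algebra.norm F x) := by
  have h : valuation F (Algebra.norm F (-1 : D)) = 1 := by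
    have h2 : valuation F (Algebra.norm F (-1 : D)) ^ 2 = 1 := by
      rw [← map_pow, ← map_pow, neg_one_sq, map_one, map_one]
    exact (pow_eq_one_iff_of_nonneg zero_le two_ne_zero).1 h2
  rw [← neg_one_mul, map_mul, map_mul, h, one_mul]

theorem valuation_norm_add_le {F D : Type*} [Field F] [ValuativeRel F] [TopologicalSpace F]
    [IsNonarchimedeanLocalField F] [DivisionRing D] [Algebra F D] [FiniteDimensional F D]
    (x y : D) : valuation F (Algebra.norm F (x + y)) ≤
      max (valuation F (Algebra.norm F x)) (valuation F (Algebra.norm F y)) := by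
  wlog h : valuation F (Algebra.norm F y) ≤ valuation F (Algebra.norm F x) generalizing x y
  · rw [add_comm, max_comm]
    exact this y x (le_of_not_ge h)
  rw [max_eq_left h]
  by_cases hx : x = 0
  · subst hx
    rw [Algebra.norm_zero, map_zero] at h ⊢
    have hy : y = 0 := by
      by_contra hy
      have h1 : IsUnit (Algebra.norm F y) := (IsUnit.mk0 y hy).map (Algebra.norm F)
      exact h1.ne_zero ((map_eq_zero _).1 (le_antisymm h zero_le))
    rw [hy, add_zero, Algebra.norm_zero, map_zero]
  · have hx' : valuation F (Algebra.norm F x) ≠ 0 := by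
      have h1 : IsUnit (Algebra.norm F x) := (IsUnit.mk0 x hx).map (Algebra.norm F)
      exact (map_ne_zero _).2 h1.ne_zero
    have h1 : valuation F (Algebra.norm F (x⁻¹ * y)) ≤ 1 := by
      have h2 : valuation F (Algebra.norm F x) * valuation F (Algebra.norm F (x⁻¹ * y)) =
          valuation F (Algebra.norm F y) := by
        rw [← map_mul, ← map_mul, mul_inv_cancel_left₀ hx]
      rw [← h2] at h
      exact le_of_mul_le_mul_left (by simpa using h) (zero_lt_iff.2 hx')
    have h3 := mul_le_mul_right (valuation_norm_one_add_le h1) (valuation F (Algebra.norm F x))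
    rwa [mul_one, ← map_mul, ← map_mul, mul_add, mul_one, mul_inv_cancel_left₀ hx] at h3


section Definitions

variable (F D : Type*) [Field F] [ValuativeRel F] [TopologicalSpace F]
  [IsNonarchimedeanLocalField F] [DivisionRing D] [Algebra F D] [FiniteDimensional F D]

/-- The ring of integers `𝒪_D = {x ∈ D : ν_D(x) ≥ 0}` of `D`.  As `N_{D/F} = Nrd ^ d`, the valuation
`ν_D = (1/d) ν_F ∘ Nrd` is `(1/d²) ν_F ∘ N_{D/F}`, where `N_{D/F}(x)` is the determinant of left
multiplication by `x`; so `ν_D(x) ≥ 0` means that `N_{D/F}(x)` is integral in `F`. -/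
def ringOfIntegers : Subring D where
  carrier := {x | valuation F (Algebra.norm F x) ≤ 1}
  one_mem' := by simp
  zero_mem' := by simp [Algebra.norm_zero]
  mul_mem' {x y} hx hy := by
    simp only [Set.mem_ofPred_eq, map_mul] at *
    exact mul_le_one' hx hy
  neg_mem' {x} hx := by
    simpa only [Set.mem_ofPred_eq, valuation_norm_neg] using hx
  add_mem' {x y} hx hy := by
    simp only [Set.mem_ofPred_eq] at *
    exact (valuation_norm_add_le x y).trans (max_le hx hy)

/-- The maximal ideal `{x ∈ D : ν_D(x) > 0}` of `𝒪_D`. -/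
def maximalIdeal : Ideal (ringOfIntegers F D) where
  carrier := {x | valuation F (Algebra.norm F (x : D)) < 1}
  zero_mem' := by simp [Algebra.norm_zero]
  add_mem' {x y} hx hy := by
    simp only [Set.mem_ofPred_eq] at *
    exact (valuation_norm_add_le (x : D) (y : D)).trans_lt (max_lt hx hy)
  smul_mem' c x hx := by
    simp only [Set.mem_ofPred_eq, smul_eq_mul, Subring.coe_mul, map_mul] at *
    exact lt_of_le_of_lt (mul_le_of_le_one_left zero_le c.2) hx

instance : (maximalIdeal F D).IsTwoSided where
  mul_mem_of_left {x} y hx := by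
    change valuation F (Algebra.norm F ((x : D) * (y : D))) < 1
    rw [map_mul, map_mul]
    exact lt_of_le_of_lt (mul_le_of_le_one_right zero_le y.2) hx

/-- The residue field `k_D` of `D`. -/
def ResidueField : Type _ := ringOfIntegers F D ⧸ maximalIdeal F D

instance : Ring (ResidueField F D) :=
  inferInstanceAs (Ring (ringOfIntegers F D ⧸ maximalIdeal F D))

/-- The reduction map `𝒪_D → k_D`. -/
def residue : ringOfIntegers F D →+* ResidueField F D := Ideal.Quotient.mk (maximalIdeal F D)

instance : Nontrivial (ResidueField F D) :=
  Ideal.Quotient.nontrivial_iff.2 fun h => by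
    have h1 : (1 : ringOfIntegers F D) ∈ maximalIdeal F D := h ▸ Submodule.mem_top
    have h2 : valuation F (Algebra.norm F (1 : D)) < 1 := h1
    simp at h2

theorem residue_isUnit_or_eq_zero (a : ResidueField F D) : IsUnit a ∨ a = 0 := by
  obtain ⟨x, rfl⟩ : ∃ x, residue F D x = a := Ideal.Quotient.mk_surjective a
  by_cases hx : x ∈ maximalIdeal F D
  · exact Or.inr (Ideal.Quotient.eq_zero_iff_mem.2 hx)
  · left
    have h1 : valuation F (Algebra.norm F (x : D)) = 1 := le_antisymm x.2 (not_lt.1 hx)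
    have h0 : (x : D) ≠ 0 := by
      intro h
      rw [h, Algebra.norm_zero, map_zero] at h1
      exact zero_ne_one h1
    have hy : (x : D)⁻¹ ∈ ringOfIntegers F D := by
      change valuation F (Algebra.norm F (x : D)⁻¹) ≤ 1
      have h2 : valuation F (Algebra.norm F (x : D)) * valuation F (Algebra.norm F (x : D)⁻¹) = 1 := by
        rw [← map_mul, ← map_mul, mul_inv_cancel₀ h0, map_one, map_one]
      rw [h1, one_mul] at h2
      exact h2.le
    refine IsUnit.map (residue F D) ⟨⟨x, ⟨_, hy⟩, ?_, ?_⟩, rfl⟩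
    · exact Subtype.ext (mul_inv_cancel₀ h0)
    · exact Subtype.ext (inv_mul_cancel₀ h0)

instance : DivisionRing (ResidueField F D) :=
  DivisionRing.ofIsUnitOrEqZero (residue_isUnit_or_eq_zero F D)

variable {F D}

/-- `[·] : k_D → 𝒪_D` is a Teichmüller lift: a multiplicative section of the reduction map. -/
def IsTeichmullerLift (τ : ResidueField F D →*₀ ringOfIntegers F D) : Prop :=
  ∀ a, residue F D (τ a) = a

variable (F)

/-- `ϖ` is a uniformizer of `D`: the maximal ideal `{ν_D > 0}` of `𝒪_D` is `ϖ 𝒪_D`. -/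
def IsUniformizer (ϖ : D) : Prop :=
  ∀ x : D, valuation F (Algebra.norm F x) < 1 ↔ ∃ y ∈ ringOfIntegers F D, x = ϖ * y

/-- `I_i = 1 + ϖ ^ i 𝒪_D` (used for `i ≥ 1`). -/
def congruenceSubgroup (ϖ : D) (i : ℕ) : Set Dˣ :=
  {g | ∃ y ∈ ringOfIntegers F D, (g : D) = 1 + ϖ ^ i * y}

/-- `q_i(g) = a`, where `q_i : I_i → I_i / I_{i+1} ≃ k_D` is the leading coefficient map,
`1 + [a] ϖ ^ i + ⋯ ↦ a`. -/
def LeadingCoeffEq (ϖ : D) (i : ℕ) (g : Dˣ) (a : ResidueField F D) : Prop :=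
  ∃ u : ringOfIntegers F D, (g : D) = 1 + (u : D) * ϖ ^ i ∧ residue F D u = a

/-- `[I_1, I_1] I_1 ^ p`: the closure in `Dˣ` of the subgroup generated by the commutators and the
`p`-th powers of elements of `I_1`. -/
def frattini [TopologicalSpace D] (ϖ : D) (p : ℕ) : Set Dˣ :=
  closure (Subgroup.closure
    ({g | ∃ x ∈ congruenceSubgroup F ϖ 1, ∃ y ∈ congruenceSubgroup F ϖ 1, g = x * y * x⁻¹ * y⁻¹} ∪
      {g | ∃ z ∈ congruenceSubgroup F ϖ 1, g = z ^ p}) : Set Dˣ)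

end Definitions

end LocalDivisionAlgebra

end

open ValuativeRel

noncomputable section

/-! Let `σ` be conjugation by `ϖ` on the finite field `k = k_D`, `k₀` its fixed field, `q = |k₀|`
and `s = [k : k₀]`. Everything rests on `s ≥ d > 4` and `p ∤ s`. These hold because, for a root of
unity `ζ` lifting a generator of `kˣ` and a uniformizer normalizing its powers, `F(ζ)` has degree
`s` over `F` and the powers `1, ϖ, …, ϖ^(s-1)` span `D` over it; so `d² = s * m` with `m ≤ s`
(`exists_fixedDegree_mul_eq_finrank`).

Part (1). Leading coefficients multiply with a twist by `σ`, so the equation is `a * σ b - b * σ a =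
α`. Put `a = c * b`: it becomes `b * σ b * (c - σ c) = α`. By additive Hilbert 90 a `c` exists
exactly when `z = b⁻¹` satisfies `Tr (α * z * σ z) = 0`, and then `c` is free up to `k₀`. This is a
quadratic condition over `k₀`; Chevalley–Warning on three-dimensional subspaces gives many
solutions. If every `c` lay in a proper subfield there would be too few: the proper subfields
contain about `√|k|` elements together, and each `c` has few `b` (`exists_mul_map_mul_sub_eq`).

Part (2). Start from such `a, b` for the leading coefficient of `g` and solve `x * y * t = g * y *
x` by successive approximation, with `t` central. Changing `x, y` in degree `n` changes the error in
degree `n + 1` by the sum of a multiple of `ker Tr` attached to `a` and one attached to `b`. These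
hyperplanes span `k` unless `σ ^ (n + 1)` fixes `a / b`, that is, since `a / b` generates `k`,
unless `s ∣ n + 1`. In those degrees `F` has elements of every leading coefficient in `k₀`, and as
`p ∤ s` they supply the missing line. Compactness turns approximations into a solution `g = [x, y] *
t` with `t ∈ F`. Taking norms, `t ^ d²` is the `p`-th power of a unit, because `g` lies in the
closed group generated by commutators and `p`-th powers; as `p ∤ d`, so is `t`. -/

namespace LocalDivisionAlgebra

/-! ### Linear equations over a cyclic extension of finite fields -/

section CyclicGalois

variable {k₀ k : Type*} [Field k₀] [Field k] [Algebra k₀ k]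

theorem trace_map_eq (σ : Gal(k/k₀)) (x : k) :
    Algebra.trace k₀ k (σ x) = Algebra.trace k₀ k x :=
  Algebra.trace_eq_of_algEquiv σ x

/-- The twisted power `a * σ a * ⋯ * σ ^ (n - 1) a`. -/
def twistedPow (σ : Gal(k/k₀)) (a : k) (n : ℕ) : k := ∏ i ∈ Finset.range n, (σ ^ i) a

theorem twistedPow_succ (σ : Gal(k/k₀)) (a : k) (n : ℕ) :
    twistedPow σ a (n + 1) = twistedPow σ a n * (σ ^ n) a := Finset.prod_range_succ _ _

theorem mul_map_twistedPow (σ : Gal(k/k₀)) (a : k) (n : ℕ) :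
    a * σ (twistedPow σ a n) = twistedPow σ a (n + 1) := by
  rw [twistedPow, twistedPow, Finset.prod_range_succ', map_prod, mul_comm]
  simp [pow_succ']

theorem twistedPow_ne_zero (σ : Gal(k/k₀)) {a : k} (ha : a ≠ 0) (n : ℕ) :
    twistedPow σ a n ≠ 0 :=
  Finset.prod_ne_zero_iff.2 fun _ _ => (map_ne_zero _).2 ha

/-- The product of length `n + 1` arises from that of length `n` by applying `σ` and adding a first
factor, or by adding a last factor; compare the two. -/
theorem map_twistedPow_eq_iff (σ : Gal(k/k₀)) {a : k} (ha : a ≠ 0) (n : ℕ) :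
    σ (twistedPow σ a n) = twistedPow σ a n ↔ (σ ^ n) a = a := by
  rw [← mul_right_inj' ha, mul_map_twistedPow, twistedPow_succ, mul_comm a,
    mul_right_inj' (twistedPow_ne_zero σ ha n)]

/-- The substitution `v = twistedPow σ a n * w` turns the operator `v ↦ a * σ v - v * (σ ^ n) a` of
the approximation step into a multiple of `σ - 1`. -/
theorem mul_map_sub_eq (σ : Gal(k/k₀)) (a w : k) (n : ℕ) :
    a * σ (twistedPow σ a n * w) - twistedPow σ a n * w * (σ ^ n) a =
      twistedPow σ a (n + 1) * (σ w - w) := by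
  rw [map_mul, ← mul_assoc, mul_map_twistedPow, twistedPow_succ]
  ring

variable [Finite k]

theorem mem_range_algebraMap_iff {σ : Gal(k/k₀)} (hσ : Subgroup.zpowers σ = ⊤) (x : k) :
    x ∈ Set.range (algebraMap k₀ k) ↔ σ x = x := by
  have : Finite k₀ := Finite.of_injective _ (algebraMap k₀ k).injective
  rw [IsGalois.mem_range_algebraMap_iff_fixed]
  refine ⟨fun h => h σ, fun h g => ?_⟩
  have hg : g ∈ Subgroup.zpowers σ := hσ ▸ Subgroup.mem_top g
  have hle : Subgroup.zpowers σ ≤ MulAction.stabilizer Gal(k/k₀) x :=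
    (Subgroup.zpowers_le).2 h
  exact hle hg

theorem orderOf_eq_finrank {σ : Gal(k/k₀)} (hσ : Subgroup.zpowers σ = ⊤) :
    orderOf σ = Module.finrank k₀ k := by
  have : Finite k₀ := Finite.of_injective _ (algebraMap k₀ k).injective
  rw [← IsGalois.card_aut_eq_finrank, ← Nat.card_zpowers, hσ, Subgroup.card_top]

/-- Additive Hilbert 90, by dimension: the range of `σ - 1` lies in the kernel of the trace, and
both have codimension one since `ker (σ - 1) = k₀`. -/
theorem exists_map_sub_eq_iff {σ : Gal(k/k₀)} (hσ : Subgroup.zpowers σ = ⊤) (x : k) :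
    (∃ w, σ w - w = x) ↔ Algebra.trace k₀ k x = 0 := by
  have : Finite k₀ := Finite.of_injective _ (algebraMap k₀ k).injective
  let f : k →ₗ[k₀] k := σ.toLinearMap - LinearMap.id
  have hle : LinearMap.range f ≤ LinearMap.ker (Algebra.trace k₀ k) := by
    rintro _ ⟨w, rfl⟩
    simp [f, trace_map_eq]
  have hker : LinearMap.ker f = 1 := by
    ext x
    rw [LinearMap.mem_ker, Submodule.mem_one]
    change σ x - x = 0 ↔ _
    rw [sub_eq_zero, ← mem_range_algebraMap_iff hσ]
    rfl
  have h1 := f.finrank_range_add_finrank_ker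
  have h2 := (Algebra.trace k₀ k).finrank_range_add_finrank_ker
  rw [LinearMap.range_eq_top.2 (Algebra.trace_surjective k₀ k), finrank_top,
    Module.finrank_self] at h2
  have h3 : Module.finrank k₀ (1 : Submodule k₀ k) = 1 := by
    rw [Submodule.one_eq_span]
    exact finrank_span_singleton one_ne_zero
  rw [hker, h3] at h1
  have h4 := Submodule.eq_of_le_of_finrank_eq hle (by omega)
  rw [← LinearMap.mem_ker, ← h4, LinearMap.mem_range]
  rfl

/-- `Tr (l * (σ w - w)) = Tr ((σ⁻¹ l - l) * w)` takes every value when `σ` moves `l`, so `w` can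
absorb the trace of `e` and Hilbert 90 does the rest. -/
theorem exists_add_mul_map_sub_eq {σ : Gal(k/k₀)} (hσ : Subgroup.zpowers σ = ⊤) {l : k}
    (hl : σ l ≠ l) (e : k) : ∃ w u, l * (σ w - w) + (σ u - u) = e := by
  have : Finite k₀ := Finite.of_injective _ (algebraMap k₀ k).injective
  obtain ⟨w₀, hw₀⟩ := Algebra.trace_surjective k₀ k (Algebra.trace k₀ k e)
  have hl' : σ.symm l - l ≠ 0 := by
    rw [sub_ne_zero]
    intro h
    exact hl (by rw [← h, σ.apply_symm_apply, h])
  obtain ⟨u, hu⟩ := (exists_map_sub_eq_iff hσ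
    (e - l * (σ (w₀ / (σ.symm l - l)) - w₀ / (σ.symm l - l)))).2 (by
      have h1 : Algebra.trace k₀ k (l * σ (w₀ / (σ.symm l - l))) =
          Algebra.trace k₀ k (σ.symm l * (w₀ / (σ.symm l - l))) := by
        rw [← trace_map_eq σ (σ.symm l * _), _root_.map_mul σ, σ.apply_symm_apply]
      rw [mul_sub, map_sub, map_sub, h1, ← map_sub, ← sub_mul, mul_div_cancel₀ _ hl', hw₀,
        sub_self])
  exact ⟨w₀ / (σ.symm l - l), u, by rw [hu, add_sub_cancel]⟩

theorem exists_commutator_correction {σ : Gal(k/k₀)} (hσ : Subgroup.zpowers σ = ⊤) {a b : k}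
    (ha : a ≠ 0) (hb : b ≠ 0) {n : ℕ} (hn : (σ ^ (n + 1)) (a / b) ≠ a / b) (e : k) :
    ∃ u v, a * σ v - v * (σ ^ n) a + (u * (σ ^ n) b - b * σ u) = e := by
  have hb' := twistedPow_ne_zero σ hb (n + 1)
  obtain ⟨w, u, h⟩ := exists_add_mul_map_sub_eq hσ
    (l := twistedPow σ a (n + 1) / twistedPow σ b (n + 1)) (by
      have h1 : twistedPow σ a (n + 1) / twistedPow σ b (n + 1) = twistedPow σ (a / b) (n + 1) := by
        simp [twistedPow, Finset.prod_div_distrib]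
      rw [h1, ne_eq, map_twistedPow_eq_iff σ (div_ne_zero ha hb)]
      exact hn) (e / twistedPow σ b (n + 1))
  refine ⟨- (twistedPow σ b n * u), twistedPow σ a n * w, ?_⟩
  have h2 := mul_map_sub_eq σ a w n
  have h3 := mul_map_sub_eq σ b u n
  rw [map_neg, h2]
  rw [eq_div_iff hb'] at h
  rw [← h, add_mul, mul_right_comm, div_mul_cancel₀ _ hb', mul_comm (σ u - u), ← h3]
  ring

/-- Here `N = twistedPow σ a (n + 1)` is fixed by `σ`, and varying `v` alone reaches `N * ker Tr`.
The complement is `N * k₀ = k₀`, because an element `t` of `k₀` has trace `[k : k₀] * t` and the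
degree is prime to `p`. -/
theorem exists_commutator_correction_add {p : ℕ} [CharP k p] [Fact p.Prime] {σ : Gal(k/k₀)}
    (hσ : Subgroup.zpowers σ = ⊤) (hp : ¬ p ∣ Module.finrank k₀ k) {a : k} (b : k)
    (ha : a ≠ 0) {n : ℕ} (hn : σ ^ (n + 1) = 1) (e : k) :
    ∃ u v h, σ h = h ∧ a * σ v - v * (σ ^ n) a + (u * (σ ^ n) b - b * σ u) + h = e := by
  set N := twistedPow σ a (n + 1) with hN
  have hN0 : N ≠ 0 := twistedPow_ne_zero σ ha _
  have hNσ : σ N = N := (map_twistedPow_eq_iff σ ha _).2 (by rw [hn]; rfl)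
  have hs : (algebraMap k₀ k) (Module.finrank k₀ k : k₀) ≠ 0 := by
    rw [map_natCast, ne_eq, CharP.cast_eq_zero_iff k p]
    exact hp
  have hs' : (Module.finrank k₀ k : k₀) ≠ 0 := fun h => hs (by rw [h, map_zero])
  set t : k₀ := Algebra.trace k₀ k (e / N) / Module.finrank k₀ k with ht
  obtain ⟨w, hw⟩ := (exists_map_sub_eq_iff hσ (e / N - algebraMap k₀ k t)).2 (by
    rw [map_sub, Algebra.trace_algebraMap, nsmul_eq_mul, mul_div_cancel₀ _ hs', sub_self])
  refine ⟨0, twistedPow σ a n * w, N * algebraMap k₀ k t, ?_, ?_⟩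
  · rw [map_mul, hNσ, AlgEquiv.commutes]
  · rw [mul_map_sub_eq, ← hN, hw, map_zero]
    field_simp
    ring

end CyclicGalois

/-! ### Counting: a residue pair outside all proper subfields -/

theorem exists_isotropic_of_ternary {K : Type*} [Field K] [Finite K] (B : Fin 3 → Fin 3 → K) :
    ∃ x : Fin 3 → K, x ≠ 0 ∧ ∑ i, ∑ j, B i j * x i * x j = 0 := by
  classical
  have := Fintype.ofFinite K
  obtain ⟨p, hp⟩ := CharP.exists K
  have : Fact p.Prime := ⟨CharP.char_is_prime K p⟩
  let f : MvPolynomial (Fin 3) K :=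
    ∑ i, ∑ j, MvPolynomial.C (B i j) * MvPolynomial.X i * MvPolynomial.X j
  have hf : ∀ x, MvPolynomial.eval x f = ∑ i, ∑ j, B i j * x i * x j := fun x => by simp [f]
  have hdeg : f.totalDegree < Fintype.card (Fin 3) := by
    refine lt_of_le_of_lt (MvPolynomial.totalDegree_finsetSum_le (d := 2) fun i _ =>
      MvPolynomial.totalDegree_finsetSum_le fun j _ => ?_) (by simp)
    refine (MvPolynomial.totalDegree_mul _ _).trans ?_
    have h1 := MvPolynomial.totalDegree_mul (MvPolynomial.C (B i j)) (MvPolynomial.X (R := K) i)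
    rw [MvPolynomial.totalDegree_C, MvPolynomial.totalDegree_X] at h1
    rw [MvPolynomial.totalDegree_X]
    omega
  have hdvd := char_dvd_card_solutions p hdeg
  by_contra! h
  have huniq : Fintype.card {x : Fin 3 → K // MvPolynomial.eval x f = 0} = 1 := by
    rw [Fintype.card_eq_one_iff]
    refine ⟨⟨0, (hf 0).trans (by simp)⟩, fun ⟨x, hx⟩ => Subtype.ext ?_⟩
    by_contra hx0
    exact h x hx0 (by rw [← hf, hx])
  rw [huniq, Nat.dvd_one] at hdvd
  exact (Fact.out : p.Prime).one_lt.ne' hdvd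

section Counting

variable {k₀ k : Type*} [Field k₀] [Field k] [Finite k] [Algebra k₀ k]

/-- Averaging: fix a three-dimensional `k₀`-subspace. Each of its `|k| - 1` multiples `l * W`
contains an isotropic line, and a given nonzero vector lies in at most `q² + q + 1` multiples, up to
scalars in `k₀`. -/
theorem card_sub_one_le_card_isotropic (σ : Gal(k/k₀)) (α : k) (hd : 3 ≤ Module.finrank k₀ k) :
    Nat.card k - 1 ≤ Nat.card {z : k // z ≠ 0 ∧ Algebra.trace k₀ k (α * (z * σ z)) = 0} *
      (Nat.card k₀ ^ 2 + Nat.card k₀ + 1) := by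
  have : Finite k₀ := Finite.of_injective _ (algebraMap k₀ k).injective
  let e := Module.finBasis k₀ k
  let ι : Fin 3 → Fin (Module.finrank k₀ k) := Fin.castLE hd
  let w : (Fin 3 → k₀) → k := fun x => ∑ i, x i • e (ι i)
  have hw : ∀ x, w x = 0 → x = 0 := fun x hx => funext
    (Fintype.linearIndependent_iff.1 (e.linearIndependent.comp ι (Fin.castLE_injective hd)) x hx)
  have hQ : ∀ l : kˣ, ∃ x : Fin 3 → k₀, x ≠ 0 ∧ ∀ t : k₀,
      Algebra.trace k₀ k (α * ((l * w (t • x)) * σ (l * w (t • x)))) = 0 := by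
    intro l
    obtain ⟨x, hx, h⟩ := exists_isotropic_of_ternary fun i j =>
      Algebra.trace k₀ k (α * ((l * e (ι i)) * σ (l * e (ι j))))
    refine ⟨x, hx, fun t => ?_⟩
    have h1 : α * ((l * w (t • x)) * σ (l * w (t • x))) = (t * t) •
        ∑ i, ∑ j, (x i * x j) • (α * ((l * e (ι i)) * σ (l * e (ι j)))) := by
      have h2 : w (t • x) = t • w x := by simp [w, Finset.smul_sum, smul_smul]
      rw [h2, mul_smul_comm, map_smul, smul_mul_smul_comm, mul_smul_comm]
      congr 1
      simp only [w, Finset.mul_sum, map_sum, Finset.sum_mul, mul_smul_comm, map_smul,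
        smul_mul_assoc]
      rw [Finset.sum_comm]
      refine Finset.sum_congr rfl fun i _ => ?_
      rw [Finset.smul_sum]
      exact Finset.sum_congr rfl fun j _ => by rw [smul_smul, mul_comm]
    rw [h1, map_smul, map_sum]
    simp only [map_sum, map_smul, smul_eq_mul]
    rw [← mul_zero (t * t), ← h]
    congr 1
    refine Finset.sum_congr rfl fun i _ => Finset.sum_congr rfl fun j _ => by ring
  choose X hX0 hX using hQ
  -- From the image `(z, x)` one recovers `l = z / w x`, then `t` from `x = t • X l`.
  let Φ : kˣ × k₀ˣ → {z : k // z ≠ 0 ∧ Algebra.trace k₀ k (α * (z * σ z)) = 0} ×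
      {x : Fin 3 → k₀ // x ≠ 0} := fun c =>
    (⟨c.1 * w ((c.2 : k₀) • X c.1), mul_ne_zero c.1.ne_zero fun h =>
      smul_ne_zero c.2.ne_zero (hX0 c.1) (hw _ h), hX c.1 c.2⟩,
      ⟨(c.2 : k₀) • X c.1, smul_ne_zero c.2.ne_zero (hX0 c.1)⟩)
  have hΦ : Function.Injective Φ := by
    rintro ⟨l, t⟩ ⟨l', t'⟩ h
    simp only [Φ, Prod.mk.injEq, Subtype.mk.injEq] at h
    obtain ⟨h1, h2⟩ := h
    have h0 : w ((t' : k₀) • X l') ≠ 0 := fun h =>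
      smul_ne_zero t'.ne_zero (hX0 l') (hw _ h)
    rw [h2] at h1
    have hl : l = l' := Units.ext (mul_right_cancel₀ h0 h1)
    subst hl
    exact Prod.ext rfl (Units.ext (smul_left_injective k₀ (hX0 l) h2))
  have hcard := Nat.card_le_card_of_injective Φ hΦ
  have h3 : Nat.card {x : Fin 3 → k₀ // x ≠ 0} = Nat.card k₀ ^ 3 - 1 := by
    classical
    have := Fintype.ofFinite k₀
    rw [Nat.card_eq_fintype_card, Fintype.card_subtype_compl]
    simp
  rw [Nat.card_prod, Nat.card_prod, Nat.card_units, Nat.card_units, h3] at hcard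
  have hq : 1 < Nat.card k₀ := Finite.one_lt_card
  obtain ⟨q, hq'⟩ : ∃ q, Nat.card k₀ = q + 2 := ⟨_, (Nat.sub_add_cancel hq).symm⟩
  rw [hq'] at hcard ⊢
  have h4 : (q + 2) ^ 3 - 1 = ((q + 2) ^ 2 + (q + 2) + 1) * (q + 2 - 1) := by
    rw [show q + 2 - 1 = q + 1 by omega, Nat.sub_eq_iff_eq_add (Nat.one_le_pow _ _ (by omega))]
    ring
  rw [h4, ← mul_assoc] at hcard
  exact Nat.le_of_mul_le_mul_right hcard (by omega)

/-- Such a `u` has `σ u = u⁻¹`, so `σ ^ 2` fixes it. Frobenius is `σ ^ j`: for `j` odd, `u ^ q =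
u⁻¹`; for `j` even, `u ∈ k₀` and `u ^ 2 = 1`. In both cases `u` is a root of unity of bounded order.
-/
theorem card_mul_map_eq_one_le {σ : Gal(k/k₀)} (hσ : Subgroup.zpowers σ = ⊤) :
    Nat.card {u : k // u * σ u = 1} ≤ Nat.card k₀ + 1 := by
  classical
  have : Finite k₀ := Finite.of_injective _ (algebraMap k₀ k).injective
  have := Fintype.ofFinite k₀
  have hq : 1 < Fintype.card k₀ := Fintype.one_lt_card
  obtain ⟨j, hj⟩ : ∃ j : ℕ, σ ^ j = FiniteField.frobeniusAlgEquivOfAlgebraic k₀ k := by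
    have h : FiniteField.frobeniusAlgEquivOfAlgebraic k₀ k ∈ Subgroup.zpowers σ :=
      hσ ▸ Subgroup.mem_top _
    exact (mem_powers_iff_mem_zpowers.2 h)
  have hpow : ∀ u : k, (σ ^ j) u = u ^ Fintype.card k₀ := fun u => by
    rw [hj, FiniteField.coe_frobeniusAlgEquivOfAlgebraic]
  obtain ⟨m, hm, hm0, H⟩ : ∃ m, m ≤ Nat.card k₀ + 1 ∧ 0 < m ∧ ∀ u : k, u * σ u = 1 → u ^ m = 1 := by
    have hstep : ∀ u : k, u * σ u = 1 → ∀ i : ℕ, (σ ^ (2 * i)) u = u := by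
      intro u hu i
      have h0 : u ≠ 0 := left_ne_zero_of_mul_eq_one hu
      have h2 : (σ ^ 2) u = u := by
        have h1 : σ u = u⁻¹ := (inv_eq_of_mul_eq_one_right hu).symm
        rw [pow_two, AlgEquiv.mul_apply, h1, map_inv₀, h1, inv_inv]
      rw [pow_mul]
      induction i with
      | zero => rfl
      | succ i ih => rw [pow_succ, AlgEquiv.mul_apply, h2, ih]
    obtain ⟨i, rfl | rfl⟩ := j.even_or_odd'
    · refine ⟨2, by rw [Nat.card_eq_fintype_card]; omega, by omega, fun u hu => ?_⟩
      have h1 : σ u = u := by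
        rw [← mem_range_algebraMap_iff hσ]
        have h2 := hpow u
        rw [hstep u hu] at h2
        rw [IsGalois.mem_range_algebraMap_iff_fixed]
        intro g
        obtain ⟨n, rfl⟩ := (FiniteField.bijective_frobeniusAlgEquivOfAlgebraic_pow k₀ k).2 g
        have h3 : FiniteField.frobeniusAlgEquivOfAlgebraic k₀ k u = u := by
          rw [← hj, hpow, ← h2]
        have h4 : ∀ n : ℕ, (FiniteField.frobeniusAlgEquivOfAlgebraic k₀ k ^ n) u = u := by
          intro n
          induction n with
          | zero => rfl
          | succ n ih => rw [pow_succ, AlgEquiv.mul_apply, h3, ih]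
        exact h4 n
      rw [pow_two]
      rwa [h1] at hu
    · refine ⟨Nat.card k₀ + 1, le_rfl, by omega, fun u hu => ?_⟩
      have h2 := hpow u
      rw [pow_succ', AlgEquiv.mul_apply, hstep u hu] at h2
      rw [pow_succ', Nat.card_eq_fintype_card, ← h2, hu]
  have : Fintype k := Fintype.ofFinite k
  rw [Nat.card_eq_fintype_card, Fintype.card_subtype]
  refine (Finset.card_le_card ?_).trans (((Multiset.toFinset_card_le _).trans
    (Polynomial.card_nthRoots m (1 : k))).trans hm)
  intro u hu
  rw [Multiset.mem_toFinset, Polynomial.mem_nthRoots hm0]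
  exact H u (Finset.mem_filter.1 hu).2

/-- `σ ^ 2` fixes `u`, and for odd order `σ` is a power of `σ ^ 2`. -/
theorem sq_eq_one_of_mul_map_eq_one {σ : Gal(k/k₀)} (hσ : Subgroup.zpowers σ = ⊤)
    (hd : Odd (Module.finrank k₀ k)) {u : k} (hu : u * σ u = 1) : u ^ 2 = 1 := by
  have h0 : u ≠ 0 := left_ne_zero_of_mul_eq_one hu
  have h1 : σ u = u⁻¹ := (inv_eq_of_mul_eq_one_right hu).symm
  have h2 : (σ ^ 2) u = u := by
    rw [pow_two, AlgEquiv.mul_apply, h1, map_inv₀, h1, inv_inv]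
  have h3 : ∀ i : ℕ, (σ ^ (2 * i)) u = u := fun i => by
    rw [pow_mul]
    induction i with
    | zero => rfl
    | succ i ih => rw [pow_succ, AlgEquiv.mul_apply, h2, ih]
  obtain ⟨i, hi⟩ := hd
  have h4 : σ ^ (2 * (i + 1)) = σ := by
    rw [show 2 * (i + 1) = 2 * i + 1 + 1 by ring, pow_succ, ← hi, ← orderOf_eq_finrank hσ,
      pow_orderOf_eq_one, one_mul]
  have h5 := h3 (i + 1)
  rw [h4] at h5
  rw [pow_two]
  rwa [h5] at hu

end Counting

/-- The elements that lie in some proper subfield. -/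
def properSubfieldUnion (k : Type*) [Field k] : Set k := {c | ∃ K : Subfield k, c ∈ K ∧ K ≠ ⊤}

theorem card_properSubfieldUnion_lt {k : Type*} [Field k] [Finite k] {p n : ℕ} [Fact p.Prime]
    [CharP k p] (hn : Nat.card k = p ^ n) :
    Nat.card (properSubfieldUnion k) * (p - 1) < p * p ^ (n / 2) := by
  classical
  have := Fintype.ofFinite k
  have hp : p.Prime := Fact.out
  -- A proper subfield has `p ^ j` elements with `1 ≤ j ≤ n / 2`, all roots of `X ^ p ^ j - X`. The
  -- value `{1}` at `j = 0` is a dummy of size `p ^ 0` that completes the geometric sum.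
  have hsub : (properSubfieldUnion k).toFinset ⊆ (Finset.range (n / 2 + 1)).biUnion fun j =>
      if j = 0 then {1} else (Polynomial.X ^ p ^ j - Polynomial.X : Polynomial k).roots.toFinset := by
    intro c hc
    rw [Set.mem_toFinset] at hc
    obtain ⟨K, hcK, hK⟩ := hc
    have := Fintype.ofFinite K
    have : CharP K p := (inferInstance : CharP K p)
    obtain ⟨j, -, hj⟩ := FiniteField.card K p
    have hcard : Nat.card k = Nat.card K ^ Module.finrank K k := Module.natCard_eq_pow_finrank
    rw [Nat.card_eq_fintype_card (α := K), hj, hn, ← pow_mul] at hcard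
    have hnj := Nat.pow_right_injective hp.two_le hcard
    have h2 : 2 ≤ Module.finrank K k := by
      have h0 : 0 < Module.finrank K k := Module.finrank_pos
      by_contra! h
      have h1 : Module.finrank K k = 1 := by omega
      apply hK
      rw [h1, mul_one] at hnj
      refine SetLike.coe_injective ?_
      rw [Subfield.coe_top]
      refine Set.eq_of_subset_of_ncard_le (Set.subset_univ _) ?_
      rw [Set.ncard_univ, hn, hnj, ← hj, ← Nat.card_eq_fintype_card]
      exact (Nat.card_coe_set_eq (K : Set k)).le
    have hjn : (j : ℕ) ≤ n / 2 := by
      rw [Nat.le_div_iff_mul_le (by omega), hnj]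
      exact Nat.mul_le_mul_left _ h2
    rw [Finset.mem_biUnion]
    refine ⟨j, Finset.mem_range.2 (by omega), ?_⟩
    rw [if_neg j.ne_zero, Multiset.mem_toFinset, Polynomial.mem_roots
      (FiniteField.X_pow_card_pow_sub_X_ne_zero k j.ne_zero hp.one_lt)]
    have h3 : (⟨c, hcK⟩ : K) ^ p ^ (j : ℕ) = ⟨c, hcK⟩ := by rw [← hj, FiniteField.pow_card]
    have h4 : c ^ p ^ (j : ℕ) = c := congrArg Subtype.val h3
    simp [h4]
  have hle : Nat.card (properSubfieldUnion k) ≤ ∑ j ∈ Finset.range (n / 2 + 1), p ^ j := by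
    rw [Nat.card_eq_card_toFinset]
    refine (Finset.card_le_card hsub).trans (Finset.card_biUnion_le.trans
      (Finset.sum_le_sum fun j _ => ?_))
    split_ifs with h
    · simp [h]
    · refine (Multiset.toFinset_card_le _).trans ((Polynomial.card_roots' _).trans ?_)
      rw [FiniteField.X_pow_card_pow_sub_X_natDegree_eq k h hp.one_lt]
  have hgeom := geom_sum_mul_add (p - 1) (n / 2 + 1)
  rw [Nat.sub_add_cancel hp.one_le] at hgeom
  rw [← pow_succ']
  have := Nat.mul_le_mul_right (p - 1) hle
  omega

/-- In the application `X = |k|`, `N` counts the admissible `z`, `B` the elements of proper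
subfields and `m` the solutions of `u * σ u = 1`. Roughly `q * N ≥ X / q` and `B ≤ p / (p - 1) *
√X`. For even `s` one has `s ≥ 6` and `p` odd, which leaves room for `m ≤ q + 1`; for odd `s`, `m ≤
2`. -/
theorem counting_inequality {p f s n q X h N B m : ℕ} (hp : 2 ≤ p) (hf : 1 ≤ f)
    (hs : 5 ≤ s) (hn : n = f * s) (hq : q = p ^ f) (hX : X = p ^ n) (hh : h = p ^ (n / 2))
    (hN : X - 1 ≤ N * (q ^ 2 + q + 1)) (hB : B * (p - 1) < p * h)
    (hm : m ≤ q + 1) (hm2 : Odd s → m ≤ 2) (hm1 : p = 2 → Odd s ∧ m ≤ 1) :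
    B * m < q * N := by
  have hX1 : 1 ≤ X := hX ▸ Nat.one_le_pow _ _ (by omega)
  have hX2 : h ^ 2 ≤ X := by
    rw [hh, hX, ← pow_mul]
    exact Nat.pow_le_pow_right (by omega) (Nat.div_mul_le_self n 2)
  have hhq : q ^ 2 ≤ h := by
    rw [hh, hq, ← pow_mul]
    refine Nat.pow_le_pow_right (by omega) ((Nat.le_div_iff_mul_le two_pos).2 ?_)
    rw [hn]
    nlinarith
  have hq2 : 2 ≤ q := hq ▸ hp.trans (Nat.le_self_pow (by omega) p)
  have hN' : X ≤ N * (q ^ 2 + q + 1) + 1 := by omega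
  by_contra! hcon
  obtain ⟨r, rfl⟩ : ∃ r, p = r + 1 := ⟨p - 1, by omega⟩
  rw [Nat.add_sub_cancel] at hB
  set T := q ^ 2 + q + 1 with hT
  have key : q * X ≤ B * m * T + q := by
    calc q * X ≤ q * (N * T + 1) := Nat.mul_le_mul_left _ hN'
      _ = q * N * T + q := by ring
      _ ≤ B * m * T + q := Nat.add_le_add_right (Nat.mul_le_mul_right _ hcon) _
  have hqX : q * h ^ 2 ≤ q * X := Nat.mul_le_mul_left _ hX2
  have hB2 : 2 ≤ r → 2 * B < 3 * h := fun hr => by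
    have h1 := Nat.mul_le_mul_left h hr
    refine Nat.lt_of_mul_lt_mul_right (a := r) ?_
    linarith
  rcases Nat.even_or_odd s with hse | hso
  · have hp3 : 2 ≤ r := by
      by_contra! hr
      exact (Nat.not_odd_iff_even.2 hse) (hm1 (by omega)).1
    have hs6 : 6 ≤ s := by
      obtain ⟨i, hi⟩ := hse
      omega
    have hq3 : 3 ≤ q := by
      rw [hq]
      exact le_trans (by omega : 3 ≤ r + 1) (Nat.le_self_pow (by omega) _)
    have hhq3 : q ^ 3 ≤ h := by
      rw [hh, hq, ← pow_mul]
      refine Nat.pow_le_pow_right (by omega) ((Nat.le_div_iff_mul_le two_pos).2 ?_)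
      rw [hn, mul_assoc]
      exact Nat.mul_le_mul_left _ hs6
    have h1 : 2 * B * m ≤ 3 * h * (q + 1) := Nat.mul_le_mul (hB2 hp3).le hm
    have h2 := Nat.mul_le_mul_right T h1
    have h3 : 3 * (q + 1) * T + 1 ≤ 2 * q * q ^ 3 := by
      obtain ⟨t, ht⟩ : ∃ t, q = t + 3 := ⟨q - 3, by omega⟩
      rw [hT, ht]
      ring_nf
      omega
    have h4 : 2 * q < h := by
      have : 3 * 3 ≤ q * q := Nat.mul_le_mul hq3 hq3
      have : 3 * 3 * q ≤ q * q * q := Nat.mul_le_mul_right _ this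
      rw [pow_succ, pow_two] at hhq3
      omega
    have h5 := Nat.mul_le_mul_left h (h3.trans (Nat.mul_le_mul_left (2 * q) hhq3))
    linarith
  · have hBm : B * m < 3 * h ∧ (r = 1 → B * m < 2 * h) := by
      rcases Nat.lt_or_ge r 2 with hr | hr
      · have hr1 : r = 1 := by omega
        subst hr1
        have := Nat.mul_le_mul_left B (hm1 rfl).2
        omega
      · have := Nat.mul_le_mul_left B (hm2 hso)
        have := hB2 hr
        omega
    rcases Nat.lt_or_ge q 4 with hq4 | hq4
    -- For `q = 2, 3` the bound `h ^ 2 ≤ X` is too weak; as `n = s` is odd, `X = p * h ^ 2` exactly.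
    · have hf1 : f = 1 := by
        by_contra hf1
        have h1 : (r + 1) ^ 2 ≤ q := hq ▸ Nat.pow_le_pow_right (by omega) (by omega)
        have h2 : 2 ^ 2 ≤ (r + 1) ^ 2 := Nat.pow_le_pow_left hp 2
        omega
      rw [hf1, pow_one] at hq
      have hXh : X = (r + 1) * h ^ 2 := by
        rw [hX, hh, ← pow_mul, ← pow_succ']
        congr 1
        rw [hf1, one_mul] at hn
        obtain ⟨i, hi⟩ := hso
        omega
      have hr : r = 1 ∨ r = 2 := by omega
      rcases hr with rfl | rfl
      · have h1 := hBm.2 rfl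
        rw [hXh, hT, hq] at key
        rw [hq] at hhq
        nlinarith
      · have h1 := hBm.1
        rw [hXh, hT, hq] at key
        rw [hq] at hhq
        nlinarith
    · have h1 : B * m * T ≤ 3 * h * T := Nat.mul_le_mul_right T hBm.1.le
      have h3 : 3 * T + 1 ≤ q * q ^ 2 := by
        obtain ⟨t, ht⟩ : ∃ t, q = t + 4 := ⟨q - 4, by omega⟩
        rw [hT, ht]
        ring_nf
        omega
      have h4 : q < h := by nlinarith
      have h5 := Nat.mul_le_mul_left h (h3.trans (Nat.mul_le_mul_left q hhq))
      linarith

theorem exists_mul_map_mul_sub_eq {k₀ k : Type*} [Field k₀] [Field k] [Finite k] [Algebra k₀ k]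
    {σ : Gal(k/k₀)} (hσ : Subgroup.zpowers σ = ⊤) {p : ℕ} [Fact p.Prime] [CharP k p]
    (hs : 5 ≤ Module.finrank k₀ k) (hps : ¬ p ∣ Module.finrank k₀ k) {α : k} (hα : α ≠ 0) :
    ∃ b c : k, b ≠ 0 ∧ b * σ b * (c - σ c) = α ∧ ∀ K : Subfield k, c ∈ K → K = ⊤ := by
  classical
  by_contra! hcon
  have : Finite k₀ := Finite.of_injective _ (algebraMap k₀ k).injective
  let S := {z : k // z ≠ 0 ∧ Algebra.trace k₀ k (α * (z * σ z)) = 0}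
  let U := {u : k // u * σ u = 1}
  have hc : ∀ z : S, ∃ c, c - σ c = α * (z.1 * σ z.1) := by
    intro z
    obtain ⟨w, hw⟩ := (exists_map_sub_eq_iff hσ _).2 z.2.2
    exact ⟨-w, by rw [map_neg, ← hw]; ring⟩
  choose C hC using hc
  have hsol : ∀ (z : S) (t : k₀), z.1⁻¹ * σ z.1⁻¹ *
      ((C z + algebraMap k₀ k t) - σ (C z + algebraMap k₀ k t)) = α := by
    intro z t
    have h0 : σ z.1 ≠ 0 := (map_ne_zero σ).2 z.2.1
    have h1 := z.2.1
    rw [map_add, AlgEquiv.commutes, add_sub_add_right_eq_sub, hC, map_inv₀]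
    field_simp
  -- A reference solution for each `c`; every other one differs from it by some `u` with `u * σ u =
  -- 1`. The default `1` is never relevant.
  let β : k → k := fun c => if h : ∃ b, b * σ b * (c - σ c) = α then h.choose else 1
  have hβ : ∀ b c, b * σ b * (c - σ c) = α → b / β c * σ (b / β c) = 1 := by
    intro b c h
    have hex : ∃ b, b * σ b * (c - σ c) = α := ⟨b, h⟩
    have h1 : β c * σ (β c) * (c - σ c) = α := by
      simp only [β, dif_pos hex]
      exact hex.choose_spec
    have h2 : c - σ c ≠ 0 := right_ne_zero_of_mul (h ▸ hα)
    have h3 : β c * σ (β c) ≠ 0 := left_ne_zero_of_mul (h1 ▸ hα)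
    rw [map_div₀, div_mul_div_comm, div_eq_one_iff_eq h3]
    exact mul_right_cancel₀ h2 (h.trans h1.symm)
  let Φ : k₀ × S → properSubfieldUnion k × U := fun x =>
    (⟨C x.2 + algebraMap k₀ k x.1, hcon _ _ (inv_ne_zero x.2.2.1) (hsol x.2 x.1)⟩,
      ⟨_, hβ _ _ (hsol x.2 x.1)⟩)
  have hΦ : Function.Injective Φ := by
    rintro ⟨t, z⟩ ⟨t', z'⟩ h
    simp only [Φ, Prod.mk.injEq] at h
    obtain ⟨h1, h2⟩ := h
    replace h1 := congrArg Subtype.val h1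
    replace h2 := congrArg Subtype.val h2
    dsimp only at h1 h2
    rw [h1] at h2
    have h3 : β (C z' + algebraMap k₀ k t') ≠ 0 := by
      intro h0
      have := hβ _ _ (hsol z' t')
      rw [h0, div_zero, zero_mul] at this
      exact zero_ne_one this
    have hz : z = z' := Subtype.ext (inv_injective ((div_left_inj' h3).1 h2))
    subst hz
    rw [add_right_inj] at h1
    exact Prod.ext ((algebraMap k₀ k).injective h1) rfl
  have hcard := Nat.card_le_card_of_injective Φ hΦ
  rw [Nat.card_prod, Nat.card_prod] at hcard
  have := Fintype.ofFinite k₀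
  have : CharP k₀ p := (RingHom.charP_iff (algebraMap k₀ k) (algebraMap k₀ k).injective p).2 ‹_›
  obtain ⟨f, -, hf⟩ := FiniteField.card k₀ p
  rw [← Nat.card_eq_fintype_card] at hf
  have hn : Nat.card k = p ^ (f * Module.finrank k₀ k) := by
    rw [Module.natCard_eq_pow_finrank (K := k₀), hf, pow_mul]
  have hp : p.Prime := Fact.out
  refine absurd hcard (not_le.2 (counting_inequality (m := Nat.card U) hp.two_le f.pos hs rfl hf hn rfl
    (card_sub_one_le_card_isotropic σ α (by omega)) (card_properSubfieldUnion_lt hn)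
    (card_mul_map_eq_one_le hσ) ?_ ?_))
  · intro hodd
    have hU : ∀ u : U, u.1 ∈ ({1, -1} : Finset k) := fun u => by
      have := sq_eq_one_of_mul_map_eq_one hσ hodd u.2
      rw [pow_two, mul_self_eq_one_iff] at this
      simpa using this
    have h := Nat.card_le_card_of_injective
      (fun u : U => (⟨u.1, hU u⟩ : {x // x ∈ ({1, -1} : Finset k)}))
      fun u v h => Subtype.ext (congrArg (fun x => x.1) h :)
    rw [Nat.card_eq_finsetCard] at h
    exact h.trans Finset.card_le_two
  · rintro rfl
    have hodd : Odd (Module.finrank k₀ k) := Nat.odd_iff.2 (by omega)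
    refine ⟨hodd, ?_⟩
    rw [Finite.card_le_one_iff_subsingleton]
    have hU : ∀ u : U, u.1 = 1 := fun u => by
      have := sq_eq_one_of_mul_map_eq_one hσ hodd u.2
      have h2 : (u.1 - 1) ^ 2 = 0 := by rw [sub_pow_char, this]; simp
      exact sub_eq_zero.1 (pow_eq_zero_iff two_ne_zero |>.1 h2)
    exact ⟨fun u v => Subtype.ext ((hU u).trans (hU v).symm)⟩

/-! ### The norm valuation and uniformizers -/

section Valuation

variable (F : Type*) {D : Type*} [Field F] [ValuativeRel F] [TopologicalSpace F]
  [IsNonarchimedeanLocalField F] [DivisionRing D] [Algebra F D] [FiniteDimensional F D]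

/-- The valuation `x ↦ v (N_{D/F} x)` of `D`. -/
def normValuation : Valuation D (ValueGroupWithZero F) where
  toFun x := valuation F (Algebra.norm F x)
  map_zero' := by rw [Algebra.norm_zero, map_zero]
  map_one' := by rw [map_one, map_one]
  map_mul' x y := by rw [map_mul, map_mul]
  map_add_le_max' := valuation_norm_add_le

theorem normValuation_apply (x : D) : normValuation F x = valuation F (Algebra.norm F x) := rfl

theorem mem_ringOfIntegers {x : D} : x ∈ ringOfIntegers F D ↔ normValuation F x ≤ 1 := Iff.rfl

theorem normValuation_algebraMap (t : F) :
    normValuation F (algebraMap F D t) = valuation F t ^ Module.finrank F D := by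
  rw [normValuation_apply, Algebra.norm_algebraMap, map_pow]

theorem normValuation_algebraMap_le_one {t : F} :
    normValuation F (algebraMap F D t) ≤ 1 ↔ valuation F t ≤ 1 := by
  rw [normValuation_algebraMap]
  exact pow_le_one_iff Module.finrank_pos.ne'

theorem normValuation_algebraMap_lt_one {t : F} :
    normValuation F (algebraMap F D t) < 1 ↔ valuation F t < 1 := by
  rw [normValuation_algebraMap]
  exact pow_lt_one_iff Module.finrank_pos.ne'

theorem normValuation_conj {x : D} (hx : x ≠ 0) (y : D) :
    normValuation F (x * y * x⁻¹) = normValuation F y := by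
  have h : normValuation F x ≠ 0 := (normValuation F).ne_zero_iff.2 hx
  rw [map_mul, map_mul, map_inv₀, mul_comm (normValuation F x), mul_inv_cancel_right₀ h]

variable {F} {ϖ : D}

theorem IsUniformizer.normValuation_lt_one (hϖ : IsUniformizer F ϖ) : normValuation F ϖ < 1 :=
  (hϖ ϖ).2 ⟨1, one_mem _, (mul_one ϖ).symm⟩

theorem IsUniformizer.ne_zero (hϖ : IsUniformizer F ϖ) : ϖ ≠ 0 := by
  rintro rfl
  obtain ⟨t, ht0, ht⟩ := Valuation.IsNontrivial.exists_lt_one (v := valuation F)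
  obtain ⟨y, -, hy⟩ := (hϖ (algebraMap F D t)).1 ((normValuation_algebraMap_lt_one F).2 ht)
  rw [zero_mul, map_eq_zero] at hy
  exact ht0 (by rw [hy])

theorem IsUniformizer.normValuation_pos (hϖ : IsUniformizer F ϖ) : 0 < normValuation F ϖ :=
  zero_lt_iff.2 ((normValuation F).ne_zero_iff.2 hϖ.ne_zero)

theorem IsUniformizer.lt_one_iff (hϖ : IsUniformizer F ϖ) {x : D} :
    normValuation F x < 1 ↔ normValuation F x ≤ normValuation F ϖ := by
  refine ⟨fun h => ?_, fun h => h.trans_lt hϖ.normValuation_lt_one⟩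
  obtain ⟨y, hy, rfl⟩ := (hϖ x).1 h
  rw [map_mul]
  exact mul_le_of_le_one_right zero_le hy

theorem IsUniformizer.of_normValuation_eq {ϖ' : D} (hϖ : IsUniformizer F ϖ)
    (h : normValuation F ϖ' = normValuation F ϖ) : IsUniformizer F ϖ' := by
  have h0 : ϖ' ≠ 0 := (normValuation F).ne_zero_iff.1 (h ▸ hϖ.normValuation_pos.ne')
  intro x
  rw [← normValuation_apply, hϖ.lt_one_iff, ← h]
  refine ⟨fun hx => ⟨ϖ'⁻¹ * x, ?_, (mul_inv_cancel_left₀ h0 x).symm⟩, ?_⟩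
  · rw [mem_ringOfIntegers, map_mul, map_inv₀, inv_mul_le_iff₀ (h ▸ hϖ.normValuation_pos), mul_one]
    exact hx
  · rintro ⟨y, hy, rfl⟩
    rw [map_mul]
    exact mul_le_of_le_one_right zero_le hy

theorem IsUniformizer.le_pow_iff (hϖ : IsUniformizer F ϖ) {x : D} {n : ℕ} :
    normValuation F x ≤ normValuation F ϖ ^ n ↔ ∃ u : ringOfIntegers F D, x = u * ϖ ^ n := by
  have h0 := pow_pos hϖ.normValuation_pos n
  constructor
  · intro h
    refine ⟨⟨x * (ϖ ^ n)⁻¹, ?_⟩, (inv_mul_cancel_right₀ (pow_ne_zero n hϖ.ne_zero) x).symm⟩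
    rw [mem_ringOfIntegers, map_mul, map_inv₀, map_pow]
    exact mul_inv_le_one_of_le₀ h zero_le
  · rintro ⟨u, rfl⟩
    rw [map_mul, map_pow]
    exact mul_le_of_le_one_left zero_le u.2

theorem IsUniformizer.le_pow_iff' (hϖ : IsUniformizer F ϖ) {x : D} {n : ℕ} :
    normValuation F x ≤ normValuation F ϖ ^ n ↔ ∃ u ∈ ringOfIntegers F D, x = ϖ ^ n * u := by
  have h0 := pow_pos hϖ.normValuation_pos n
  constructor
  · intro h
    refine ⟨(ϖ ^ n)⁻¹ * x, ?_, (mul_inv_cancel_left₀ (pow_ne_zero n hϖ.ne_zero) x).symm⟩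
    rw [mem_ringOfIntegers, map_mul, map_inv₀, map_pow, mul_comm]
    exact mul_inv_le_one_of_le₀ h zero_le
  · rintro ⟨u, hu, rfl⟩
    rw [map_mul, map_pow]
    exact mul_le_of_le_one_right zero_le hu

theorem residue_eq_zero_iff {u : ringOfIntegers F D} :
    residue F D u = 0 ↔ normValuation F (u : D) < 1 :=
  Ideal.Quotient.eq_zero_iff_mem

theorem residue_eq_iff {u v : ringOfIntegers F D} :
    residue F D u = residue F D v ↔ normValuation F (u - v : D) < 1 := by
  rw [← sub_eq_zero, ← map_sub, residue_eq_zero_iff]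
  rfl

theorem residue_surjective : Function.Surjective (residue F D) := Ideal.Quotient.mk_surjective

theorem IsUniformizer.mul_pow_le_iff (hϖ : IsUniformizer F ϖ) (u : ringOfIntegers F D) (n : ℕ) :
    normValuation F (u * ϖ ^ n : D) ≤ normValuation F ϖ ^ (n + 1) ↔ residue F D u = 0 := by
  have h0 := pow_pos hϖ.normValuation_pos n
  rw [residue_eq_zero_iff, hϖ.lt_one_iff, map_mul, map_pow, pow_succ']
  exact mul_le_mul_iff_left₀ h0

theorem IsUniformizer.exists_pow_lt (hϖ : IsUniformizer F ϖ) {γ : ValueGroupWithZero F}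
    (hγ : γ ≠ 0) : ∃ n, normValuation F ϖ ^ n < γ :=
  exists_pow_lt₀ hϖ.normValuation_lt_one (Units.mk0 γ hγ)

theorem IsUniformizer.eq_zero_of_forall_le_pow (hϖ : IsUniformizer F ϖ) {x : D}
    (h : ∀ n, normValuation F x ≤ normValuation F ϖ ^ n) : x = 0 := by
  by_contra hx
  obtain ⟨n, hn⟩ := hϖ.exists_pow_lt ((normValuation F).ne_zero_iff.2 hx)
  exact absurd (h n) (not_le.2 hn)

end Valuation

/-! ### Compactness of the integers and finiteness of the residue field -/

section Topology

variable (F : Type*) (D : Type*) [Field F] [ValuativeRel F] [TopologicalSpace F]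
  [IsNonarchimedeanLocalField F] [DivisionRing D] [Algebra F D] [FiniteDimensional F D]
  [TopologicalSpace D] [IsModuleTopology F D]

include F in
theorem isTopologicalRing : IsTopologicalRing D := IsModuleTopology.isTopologicalRing F D

theorem t2Space_base : T2Space F := by
  have := isTopologicalRing F F
  let := IsTopologicalAddGroup.rightUniformSpace F
  have := isUniformAddGroup_of_addCommGroup (G := F)
  infer_instance

/-- The coordinates with respect to a basis, as a homeomorphism. -/
def coordHomeomorph : (Fin (Module.finrank F D) → F) ≃ₜ D where
  toEquiv := (Module.finBasis F D).equivFun.symm.toEquiv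
  continuous_toFun := by
    have := isTopologicalRing F D
    exact IsModuleTopology.continuous_of_linearMap
      (Module.finBasis F D).equivFun.symm.toLinearMap
  continuous_invFun := by
    have := isTopologicalRing F D
    exact IsModuleTopology.continuous_of_linearMap (Module.finBasis F D).equivFun.toLinearMap

include F in
theorem t2Space : T2Space D := by
  have := t2Space_base F
  exact (coordHomeomorph F D).t2Space

theorem continuous_norm : Continuous (Algebra.norm F : D → F) := by
  have := isTopologicalRing F D
  have h : (Algebra.norm F : D → F) =
      fun x => (Algebra.leftMulMatrix (Module.finBasis F D) x).det :=
    funext fun x => Algebra.norm_eq_matrix_det (Module.finBasis F D) x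
  rw [h]
  refine Continuous.matrix_det (continuous_pi fun i => continuous_pi fun j => ?_)
  exact IsModuleTopology.continuous_of_linearMap (((LinearMap.proj (R := F) (φ := fun _ => F) j).comp
    (LinearMap.proj (R := F) (φ := fun _ => (_ → F)) i)).comp
    (Algebra.leftMulMatrix (Module.finBasis F D)).toLinearMap)

theorem isOpen_setOf_valuation_lt {γ : ValueGroupWithZero F} (hγ : γ ≠ 0) :
    IsOpen {x : F | valuation F x < γ} := by
  rw [isOpen_iff_mem_nhds]
  intro x hx
  rw [IsValuativeTopology.mem_nhds_iff']
  refine ⟨Units.mk0 γ hγ, fun y hy => ?_⟩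
  have h := (valuation F).map_add (y - x) x
  rw [sub_add_cancel] at h
  exact h.trans_lt (max_lt hy hx)

theorem isOpen_setOf_normValuation_lt {γ : ValueGroupWithZero F} (hγ : γ ≠ 0) :
    IsOpen {x : D | normValuation F x < γ} :=
  (isOpen_setOf_valuation_lt F hγ).preimage (continuous_norm F D)

theorem isClosed_setOf_normValuation_le (γ : ValueGroupWithZero F) :
    IsClosed {x : D | normValuation F x ≤ γ} := by
  have := t2Space_base F
  exact (IsNonarchimedeanLocalField.isCompact_closedBall F γ).isClosed.preimage
    (continuous_norm F D)

/-- The norm does not vanish on the compact unit sphere `S` of coordinate vectors, so it is bounded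
below there by some `γ`. Homogeneity of the norm then bounds the coordinates of every integral
element. -/
theorem isCompact_ringOfIntegers : IsCompact (ringOfIntegers F D : Set D) := by
  have := t2Space_base F
  set n := Module.finrank F D with hn
  let e := coordHomeomorph F D
  have he : ∀ (t : F) x, e (t • x) = t • e x := fun t x =>
    (Module.finBasis F D).equivFun.symm.map_smul t x
  let B : Set (Fin n → F) := Set.univ.pi fun _ => {x | valuation F x ≤ 1}
  have hB : IsCompact B :=
    isCompact_univ_pi fun _ => IsNonarchimedeanLocalField.isCompact_closedBall F 1
  let S : Set (Fin n → F) := ⋃ i, B ∩ {x | valuation F (x i) < 1}ᶜ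
  have hS : IsCompact S := isCompact_iUnion fun i => hB.inter_right
    (IsOpen.preimage (f := fun x : Fin n → F => x i) (continuous_apply i)
      (isOpen_setOf_valuation_lt F one_ne_zero)).isClosed_compl
  have hS0 : ∀ x ∈ S, Algebra.norm F (e x) ≠ 0 := by
    intro x hx h
    obtain ⟨i, -, hi⟩ := Set.mem_iUnion.1 hx
    have h1 : e x = 0 := by
      rw [← (normValuation F).zero_iff, normValuation_apply, h, map_zero]
    have h2 : x = 0 := by
      have h3 : e 0 = 0 := (Module.finBasis F D).equivFun.symm.map_zero
      exact e.injective (h1.trans h3.symm)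
    apply hi
    simp [h2]
  obtain ⟨γ, hγ0, hγ⟩ : ∃ γ : ValueGroupWithZero F, γ ≠ 0 ∧
      ∀ x ∈ S, γ ≤ valuation F (Algebra.norm F (e x)) := by
    have hK : IsCompact ((fun x => Algebra.norm F (e x)) '' S) :=
      hS.image ((continuous_norm F D).comp e.continuous)
    have h0 : (0 : F) ∈ ((fun x => Algebra.norm F (e x)) '' S)ᶜ := by
      rintro ⟨x, hx, h⟩
      exact hS0 x hx h
    have h1 := hK.isClosed.isOpen_compl.mem_nhds h0
    rw [IsValuativeTopology.mem_nhds_iff'] at h1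
    obtain ⟨γ, hγ⟩ := h1
    refine ⟨γ, γ.ne_zero, fun x hx => ?_⟩
    by_contra! h
    exact hγ (by simpa using h) ⟨x, hx, rfl⟩
  let R := max 1 γ⁻¹
  have hsub : (ringOfIntegers F D : Set D) ⊆
      e '' (Set.univ.pi fun _ => {x | valuation F x ≤ R}) := by
    intro y hy
    obtain ⟨x, rfl⟩ := e.surjective y
    refine ⟨x, ?_, rfl⟩
    have : Nonempty (Fin n) := ⟨⟨0, Module.finrank_pos⟩⟩
    obtain ⟨i, hi⟩ := Finite.exists_max fun i => valuation F (x i)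
    intro j _
    refine (hi j).trans ?_
    by_contra! hlt
    have hi1 : 1 < valuation F (x i) := (le_max_left _ _).trans_lt hlt
    have hi0 : x i ≠ 0 := by
      intro h
      rw [h, map_zero] at hi1
      exact not_lt_zero hi1
    have hxS : (x i)⁻¹ • x ∈ S := by
      refine Set.mem_iUnion.2 ⟨i, fun j _ => ?_, ?_⟩
      · change valuation F ((x i)⁻¹ * x j) ≤ 1
        rw [map_mul, map_inv₀]
        exact (inv_mul_le_one₀ (zero_lt_one.trans hi1)).2 (hi j)
      · simp [inv_mul_cancel₀ hi0]
    have h1 := hγ _ hxS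
    have h2 : Algebra.norm F (e x) = x i ^ n * Algebra.norm F (e ((x i)⁻¹ • x)) := by
      rw [hn, ← Algebra.norm_algebraMap (S := D), ← map_mul, ← Algebra.smul_def, ← he, smul_smul,
        mul_inv_cancel₀ hi0, one_smul]
    have h3 : valuation F (Algebra.norm F (e x)) ≤ 1 := hy
    rw [h2, map_mul, map_pow] at h3
    have h4 : valuation F (x i) ≤ valuation F (x i) ^ n :=
      le_self_pow₀ hi1.le Module.finrank_pos.ne'
    have h5 : valuation F (x i) * γ ≤ 1 := (mul_le_mul' h4 h1).trans h3
    rw [← le_div_iff₀ (zero_lt_iff.2 hγ0), one_div] at h5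
    exact absurd ((le_max_right 1 _).trans_lt hlt) (not_lt.2 h5)
  exact ((isCompact_univ_pi fun _ => IsNonarchimedeanLocalField.isCompact_closedBall F R).image
    e.continuous).of_isClosed_subset (isClosed_setOf_normValuation_le F D 1) hsub

variable {F D} {ϖ : D}

/-- The closed balls are compact and decrease to `{0}`, so they cannot all meet the complement of
`U`. -/
theorem IsUniformizer.exists_pow_subset (hϖ : IsUniformizer F ϖ) {U : Set D} (hU : IsOpen U)
    (h0 : (0 : D) ∈ U) : ∃ n, {x : D | normValuation F x ≤ normValuation F ϖ ^ n} ⊆ U := by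
  by_contra! h
  have hanti : Antitone fun n : ℕ => {x : D | normValuation F x ≤ normValuation F ϖ ^ n} :=
    fun m n hmn x hx => le_trans (Set.mem_ofPred_eq ▸ hx)
      (pow_le_pow_right_of_le_one' hϖ.normValuation_lt_one.le hmn)
  have hne := IsCompact.nonempty_iInter_of_sequence_nonempty_isCompact_isClosed
    (fun n : ℕ => {x : D | normValuation F x ≤ normValuation F ϖ ^ n} ∩ Uᶜ)
    (fun n => Set.inter_subset_inter_left _ (hanti n.le_succ))
    (fun n => Set.not_subset.1 (h n))
    (by
      rw [pow_zero]
      exact (isCompact_ringOfIntegers F D).inter_right hU.isClosed_compl)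
    (fun n => (isClosed_setOf_normValuation_le F D _).inter hU.isClosed_compl)
  obtain ⟨x, hx⟩ := hne
  rw [Set.mem_iInter] at hx
  have h1 : x = 0 := hϖ.eq_zero_of_forall_le_pow fun n => (hx n).1
  exact (hx 0).2 (h1 ▸ h0)

variable (F D)

theorem finite_residueField : Finite (ResidueField F D) := by
  have := isTopologicalRing F D
  let U : ringOfIntegers F D → Set D := fun u => {x | normValuation F (x - u : D) < 1}
  have hU : ∀ u, IsOpen (U u) := fun u =>
    (isOpen_setOf_normValuation_lt F D one_ne_zero).preimage (continuous_id.sub continuous_const)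
  obtain ⟨t, ht⟩ := (isCompact_ringOfIntegers F D).elim_finite_subcover U hU (fun x hx =>
    Set.mem_iUnion.2 ⟨⟨x, hx⟩, by simp [U]⟩)
  classical
  refine Set.finite_univ_iff.1 ((t.image (residue F D)).finite_toSet.subset fun a _ => ?_)
  obtain ⟨u, rfl⟩ := residue_surjective a
  obtain ⟨v, hv, hu⟩ := Set.mem_iUnion₂.1 (ht u.2)
  rw [Finset.mem_coe, Finset.mem_image]
  exact ⟨v, hv, (residue_eq_iff.2 hu).symm⟩

end Topology

/-! ### The fixed field of an automorphism -/

section FixedSubfield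

variable {k : Type*} [Field k]

/-- The subfield fixed by an automorphism. -/
def fixedSubfield (σ : k ≃+* k) : Subfield k := RingHom.eqLocusField (σ : k →+* k) (RingHom.id k)

/-- An automorphism as an element of the Galois group over its fixed field. -/
def toGal (σ : k ≃+* k) : Gal(k/fixedSubfield σ) := AlgEquiv.ofRingEquiv (f := σ) fun x => x.2

@[simp]
theorem toGal_apply (σ : k ≃+* k) (x : k) : toGal σ x = σ x := rfl

theorem zpowers_toGal [Finite k] (σ : k ≃+* k) : Subgroup.zpowers (toGal σ) = ⊤ := by
  have h : IntermediateField.fixedField (Subgroup.zpowers (toGal σ)) = ⊥ := by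
    rw [eq_bot_iff]
    intro x hx
    rw [IntermediateField.mem_fixedField_iff] at hx
    have h1 := hx _ (Subgroup.mem_zpowers (toGal σ))
    exact IntermediateField.mem_bot.2 ⟨⟨x, h1⟩, rfl⟩
  rw [← IntermediateField.fixingSubgroup_fixedField (Subgroup.zpowers (toGal σ)), h,
    IntermediateField.fixingSubgroup_bot]

/-- The degree of a finite field over the fixed field of an automorphism. -/
def fixedDegree (σ : k ≃+* k) : ℕ := Module.finrank (fixedSubfield σ) k

theorem orderOf_toGal [Finite k] (σ : k ≃+* k) : orderOf (toGal σ) = fixedDegree σ :=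
  orderOf_eq_finrank (zpowers_toGal σ)

end FixedSubfield

/-! ### Conjugation on the residue field -/

section Residue

variable {F D : Type*} [Field F] [ValuativeRel F] [TopologicalSpace F]
  [IsNonarchimedeanLocalField F] [DivisionRing D] [Algebra F D] [FiniteDimensional F D]

variable (F) in
/-- Conjugation by a nonzero element, as an endomorphism of `𝒪_D`. -/
def conjIntegers {x : D} (hx : x ≠ 0) : ringOfIntegers F D →+* ringOfIntegers F D where
  toFun u := ⟨x * u * x⁻¹, by
    rw [mem_ringOfIntegers, normValuation_conj F hx]
    exact u.2⟩
  map_one' := Subtype.ext (by simp [mul_inv_cancel₀ hx])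
  map_zero' := Subtype.ext (by simp)
  map_add' u v := Subtype.ext (by simp [mul_add, add_mul])
  map_mul' u v := Subtype.ext (by simp [mul_assoc, inv_mul_cancel_left₀ hx])

variable (F) in
theorem coe_conjIntegers {x : D} (hx : x ≠ 0) (u : ringOfIntegers F D) :
    (conjIntegers F hx u : D) = x * u * x⁻¹ := rfl

variable (F) in
/-- Conjugation by a nonzero element, as an endomorphism of the residue field. -/
def residueConjHom {x : D} (hx : x ≠ 0) : ResidueField F D →+* ResidueField F D :=
  Ideal.Quotient.lift (maximalIdeal F D) ((residue F D).comp (conjIntegers F hx)) fun u hu => by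
    rw [RingHom.comp_apply, residue_eq_zero_iff, coe_conjIntegers, normValuation_conj F hx]
    exact hu

variable [Finite (ResidueField F D)]

variable (F) in
/-- Conjugation by a nonzero element, as an automorphism of the residue field. -/
def residueConj {x : D} (hx : x ≠ 0) : ResidueField F D ≃+* ResidueField F D :=
  RingEquiv.ofBijective (residueConjHom F hx)
    (Finite.injective_iff_bijective.1 (residueConjHom F hx).injective)

theorem residueConj_residue {x : D} (hx : x ≠ 0) (u : ringOfIntegers F D) :
    residueConj F hx (residue F D u) = residue F D (conjIntegers F hx u) := rfl

/-- Two uniformizers differ by a unit, and units act trivially because a finite division ring is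
commutative. -/
theorem IsUniformizer.residueConj_eq {ϖ ϖ' : D} (hϖ : IsUniformizer F ϖ)
    (hϖ' : IsUniformizer F ϖ') : residueConj F hϖ.ne_zero = residueConj F hϖ'.ne_zero := by
  have hle : ∀ {x y : D}, IsUniformizer F x → IsUniformizer F y →
      ∃ u : ringOfIntegers F D, y = u * x := by
    intro x y hx hy
    have := hx.le_pow_iff (n := 1) (x := y)
    rw [pow_one, pow_one] at this
    exact this.1 (hx.lt_one_iff.1 hy.normValuation_lt_one)
  obtain ⟨u, hu⟩ := hle hϖ hϖ'
  obtain ⟨v, hv⟩ := hle hϖ' hϖ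
  have hvu : v * u = 1 := Subtype.ext (mul_right_cancel₀ hϖ.ne_zero (by
    rw [Subring.coe_mul, mul_assoc, ← hu, ← hv, Subring.coe_one, one_mul]))
  ext a
  obtain ⟨a, rfl⟩ := residue_surjective a
  have h1 : conjIntegers F hϖ'.ne_zero a * u = u * conjIntegers F hϖ.ne_zero a := by
    apply Subtype.ext
    apply mul_right_cancel₀ hϖ.ne_zero
    simp only [Subring.coe_mul, coe_conjIntegers]
    rw [mul_assoc (u : D), inv_mul_cancel_right₀ hϖ.ne_zero, mul_assoc _ (u : D), ← hu,
      inv_mul_cancel_right₀ hϖ'.ne_zero, ← mul_assoc, ← hu]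
  have h2 := congrArg (residue F D) h1
  rw [map_mul, map_mul, mul_comm] at h2
  have h3 : residue F D u ≠ 0 := fun h => by
    have := congrArg (residue F D) hvu
    rw [map_mul, h, mul_zero, map_one] at this
    exact zero_ne_one this
  exact (mul_left_cancel₀ h3 h2).symm

theorem residueConj_pow {x : D} (hx : x ≠ 0) (n : ℕ) (a : ResidueField F D) :
    (toGal (residueConj F hx) ^ n) a = residueConj F (pow_ne_zero n hx) a := by
  obtain ⟨u, rfl⟩ := residue_surjective a
  induction n with
  | zero =>
    rw [residueConj_residue]
    exact congrArg (residue F D) (Subtype.ext (by simp [coe_conjIntegers]))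
  | succ n ih =>
    rw [pow_succ', AlgEquiv.mul_apply, ih, toGal_apply, residueConj_residue, residueConj_residue,
      residueConj_residue]
    refine congrArg (residue F D) (Subtype.ext ?_)
    simp only [coe_conjIntegers, pow_succ', mul_inv_rev, mul_assoc]

/-- In `a ^ Q - b ^ Q = (∑ a ^ i * b ^ (Q - 1 - i)) * (a - b)` the sum reduces to `Q * b ^ (Q - 1) =
0`. -/
theorem IsUniformizer.pow_card_sub_pow_card_le {ϖ : D} (hϖ : IsUniformizer F ϖ) {a b : ringOfIntegers F D}
    (hab : Commute a b) {m : ℕ} (h : normValuation F (a - b : D) ≤ normValuation F ϖ ^ (m + 1)) :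
    normValuation F ((a : D) ^ Nat.card (ResidueField F D) - (b : D) ^ Nat.card (ResidueField F D)) ≤
      normValuation F ϖ ^ (m + 2) := by
  set Q := Nat.card (ResidueField F D) with hQ
  have hres : residue F D a = residue F D b := by
    rw [residue_eq_iff]
    exact h.trans_lt (pow_lt_one₀ zero_le hϖ.normValuation_lt_one (by omega))
  have h1 := hab.geom_sum₂_mul Q
  have h2 : residue F D (∑ i ∈ Finset.range Q, a ^ i * b ^ (Q - 1 - i)) = 0 := by
    rw [map_sum]
    have : ∀ i ∈ Finset.range Q, residue F D (a ^ i * b ^ (Q - 1 - i)) =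
        residue F D b ^ (Q - 1) := by
      intro i hi
      rw [map_mul, map_pow, map_pow, hres, ← pow_add]
      congr 1
      have := Finset.mem_range.1 hi
      omega
    have := Fintype.ofFinite (ResidueField F D)
    rw [Finset.sum_congr rfl ‹_›, Finset.sum_const, Finset.card_range, nsmul_eq_mul, hQ,
      Nat.card_eq_fintype_card, FiniteField.cast_card_eq_zero, zero_mul]
  have h3 := congrArg (normValuation F) (congrArg (Subring.subtype _) h1)
  rw [residue_eq_zero_iff, hϖ.lt_one_iff] at h2
  simp only [map_mul, map_sub, map_pow, Subring.subtype_apply] at h3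
  rw [← h3, pow_succ']
  exact mul_le_mul' h2 h

end Residue

/-! ### Digit expansions and roots of unity -/

section Approximation

variable {F D : Type*} [Field F] [ValuativeRel F] [TopologicalSpace F]
  [IsNonarchimedeanLocalField F] [DivisionRing D] [Algebra F D] [FiniteDimensional F D]
  [TopologicalSpace D] [IsModuleTopology F D] {ϖ : D}

theorem IsUniformizer.mem_of_isClosed (hϖ : IsUniformizer F ϖ) {A : Set D} (hA : IsClosed A)
    {x : D} (h : ∀ n, ∃ a ∈ A, normValuation F (x - a) ≤ normValuation F ϖ ^ n) : x ∈ A := by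
  have := isTopologicalRing F D
  by_contra hx
  obtain ⟨n, hn⟩ := hϖ.exists_pow_subset (U := (fun y => x - y) ⁻¹' Aᶜ)
    (hA.isOpen_compl.preimage (continuous_const.sub continuous_id)) (by simpa using hx)
  obtain ⟨a, ha, hxa⟩ := h n
  have h1 := hn hxa
  rw [Set.mem_preimage, sub_sub_cancel] at h1
  exact h1 ha

/-- Expand `x` digit by digit with digits from `A`; the partial sums approximate `x`. -/
theorem IsUniformizer.integers_le_of_isClosed (hϖ : IsUniformizer F ϖ) {A : AddSubgroup D}
    (hA : IsClosed (A : Set D))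
    (h : ∀ (a : ResidueField F D) (n : ℕ), ∃ u : ringOfIntegers F D, residue F D u = a ∧
      (u : D) * ϖ ^ n ∈ A) {x : D} (hx : x ∈ ringOfIntegers F D) : x ∈ A := by
  refine hϖ.mem_of_isClosed hA fun n => ?_
  induction n with
  | zero => exact ⟨0, A.zero_mem, by rwa [sub_zero, pow_zero]⟩
  | succ n ih =>
    obtain ⟨a, ha, hxa⟩ := ih
    obtain ⟨u, hu⟩ := hϖ.le_pow_iff.1 hxa
    obtain ⟨t, ht, htA⟩ := h (residue F D u) n
    refine ⟨a + t * ϖ ^ n, A.add_mem ha htA, ?_⟩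
    rw [← sub_sub, hu, ← sub_mul]
    exact (hϖ.mul_pow_le_iff (u - t) n).2 (by rw [map_sub, ht, sub_self])

theorem exists_smul_mem_ringOfIntegers (F : Type*) {D : Type*} [Field F] [ValuativeRel F]
    [TopologicalSpace F] [IsNonarchimedeanLocalField F] [DivisionRing D] [Algebra F D]
    [FiniteDimensional F D] (x : D) : ∃ t : F, t ≠ 0 ∧ t • x ∈ ringOfIntegers F D := by
  rcases le_total (normValuation F x) 1 with h | h
  · exact ⟨1, one_ne_zero, by rwa [one_smul]⟩
  · have h0 : Algebra.norm F x ≠ 0 := by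
      intro h0
      rw [normValuation_apply, h0, map_zero] at h
      exact absurd h (not_le.2 zero_lt_one)
    refine ⟨(Algebra.norm F x)⁻¹, inv_ne_zero h0, ?_⟩
    rw [mem_ringOfIntegers, Algebra.smul_def, map_mul, normValuation_algebraMap, map_inv₀,
      ← normValuation_apply]
    have h1 : (normValuation F x)⁻¹ ≤ 1 := inv_le_one_of_one_le₀ h
    calc (normValuation F x)⁻¹ ^ Module.finrank F D * normValuation F x
        ≤ (normValuation F x)⁻¹ * normValuation F x := by
          refine mul_le_mul_left (pow_le_of_le_one zero_le h1 Module.finrank_pos.ne') _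
      _ = 1 := inv_mul_cancel₀ (zero_lt_one.trans_le h).ne'

variable [Finite (ResidueField F D)]

theorem IsUniformizer.exists_pow_card_eq (hϖ : IsUniformizer F ϖ) (g : ResidueField F D) :
    ∃ ζ : ringOfIntegers F D, residue F D ζ = g ∧ ζ ^ Nat.card (ResidueField F D) = ζ := by
  have := isTopologicalRing F D
  have := t2Space F D
  set Q := Nat.card (ResidueField F D) with hQ
  have hgQ : ∀ a : ResidueField F D, a ^ Q = a := fun a => by
    have := Fintype.ofFinite (ResidueField F D)
    rw [hQ, Nat.card_eq_fintype_card, FiniteField.pow_card]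
  obtain ⟨x, rfl⟩ := residue_surjective g
  -- The usual limit of `x ^ Q ^ m`, taken as a point in the intersection of compact sets, the
  -- `m`-th of which contains `x ^ Q ^ m`.
  let C : ℕ → Set D := fun m => {y | normValuation F (y - x) ≤ normValuation F ϖ} ∩
    ({y | normValuation F (y ^ Q - y) ≤ normValuation F ϖ ^ m} ∩ ringOfIntegers F D)
  have hCc : ∀ m, IsClosed (C m) := fun m =>
    (IsClosed.preimage (f := fun y : D => y - x) (continuous_id.sub continuous_const)
      (isClosed_setOf_normValuation_le F D (normValuation F ϖ))).inter
    ((IsClosed.preimage (f := fun y : D => y ^ Q - y) ((continuous_pow Q).sub continuous_id)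
      (isClosed_setOf_normValuation_le F D (normValuation F ϖ ^ m))).inter (isCompact_ringOfIntegers F D).isClosed)
  have hpow : ∀ m, normValuation F (((x ^ Q ^ m : ringOfIntegers F D) : D) ^ Q -
      ((x ^ Q ^ m : ringOfIntegers F D) : D)) ≤ normValuation F ϖ ^ (m + 1) := by
    intro m
    induction m with
    | zero =>
      rw [pow_zero, pow_one, zero_add, pow_one, ← hϖ.lt_one_iff]
      have h1 : residue F D (x ^ Q) = residue F D x := by rw [map_pow, hgQ]
      rw [residue_eq_iff] at h1
      simpa using h1
    | succ m ih =>
      have h2 := hϖ.pow_card_sub_pow_card_le (a := x ^ (Q ^ m * Q)) (b := x ^ Q ^ m)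
        (Commute.pow_pow_self x _ _) (m := m) (by
          simpa [pow_mul] using ih)
      simpa [pow_succ, pow_mul] using h2
  obtain ⟨ζ, hζ⟩ := IsCompact.nonempty_iInter_of_sequence_nonempty_isCompact_isClosed C
    (fun m y hy => ⟨hy.1, le_trans (Set.mem_ofPred_eq ▸ hy.2.1)
      (pow_le_pow_right_of_le_one' hϖ.normValuation_lt_one.le m.le_succ), hy.2.2⟩)
    (fun m => ⟨((x ^ Q ^ m : ringOfIntegers F D) : D), by
      refine ⟨?_, ?_, (x ^ Q ^ m).2⟩
      · have h1 : residue F D (x ^ Q ^ m) = residue F D x := by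
          rw [map_pow]
          clear hpow
          induction m with
          | zero => rw [pow_zero, pow_one]
          | succ m ih => rw [pow_succ, pow_mul, ih, hgQ]
        exact hϖ.lt_one_iff.1 (residue_eq_iff.1 h1)
      · exact (hpow m).trans
          (pow_le_pow_right_of_le_one' hϖ.normValuation_lt_one.le m.le_succ)⟩)
    (((isCompact_ringOfIntegers F D).of_isClosed_subset (hCc 0) fun y hy => hy.2.2)) hCc
  rw [Set.mem_iInter] at hζ
  refine ⟨⟨ζ, (hζ 0).2.2⟩, ?_, Subtype.ext ?_⟩
  · exact residue_eq_iff.2 (hϖ.lt_one_iff.2 (hζ 0).1)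
  · exact sub_eq_zero.1 (hϖ.eq_zero_of_forall_le_pow fun n => (hζ n).2.1)

end Approximation

/-! ### A uniformizer normalizing a root of unity, and the degree of the residue action -/

section MonomialPair

variable {F D : Type*} [Field F] [ValuativeRel F] [TopologicalSpace F]
  [IsNonarchimedeanLocalField F] [DivisionRing D] [Algebra F D] [FiniteDimensional F D]
  [Finite (ResidueField F D)]

variable (F) in
/-- A uniformizer `ϖ` and a root of unity `ζ` generating the residue field multiplicatively, such
that conjugation by `ϖ` acts on `ζ` as a power map. -/
structure IsMonomialPair (ϖ : D) (ζ : ringOfIntegers F D) (g : (ResidueField F D)ˣ) (r : ℕ) :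
    Prop where
  isUniformizer : IsUniformizer F ϖ
  residue_eq : residue F D ζ = g
  mem_zpowers : ∀ a, a ∈ Subgroup.zpowers g
  pow_orderOf : ζ ^ orderOf g = 1
  mul_eq : ϖ * ζ = (ζ : D) ^ r * ϖ

variable {ϖ : D} {ζ : ringOfIntegers F D} {g : (ResidueField F D)ˣ} {r : ℕ}

namespace IsMonomialPair

theorem pow_eq_pow (h : IsMonomialPair F ϖ ζ g r) {i j : ℕ} (hij : g ^ i = g ^ j) :
    ζ ^ i = ζ ^ j := by
  have h1 : i % orderOf g = j % orderOf g := pow_eq_pow_iff_modEq.1 hij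
  rw [pow_eq_pow_mod i h.pow_orderOf, pow_eq_pow_mod j h.pow_orderOf, h1]

theorem exists_pow (h : IsMonomialPair F ϖ ζ g r) (a : ResidueField F D) :
    a = 0 ∨ ∃ j : ℕ, a = (g : ResidueField F D) ^ j := by
  by_cases ha : a = 0
  · exact Or.inl ha
  · obtain ⟨j, hj⟩ := mem_powers_iff_mem_zpowers.2 (h.mem_zpowers (Units.mk0 a ha))
    refine Or.inr ⟨j, ?_⟩
    have := congrArg Units.val hj
    simpa using this.symm

theorem uniformizer_mul_pow (h : IsMonomialPair F ϖ ζ g r) (j : ℕ) :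
    ϖ * (ζ : D) ^ j = (ζ : D) ^ (r * j) * ϖ := by
  induction j with
  | zero => simp
  | succ j ih => rw [pow_succ, ← mul_assoc, ih, mul_assoc, h.mul_eq, ← mul_assoc, ← pow_add,
      mul_add, mul_one]

theorem uniformizer_pow_mul (h : IsMonomialPair F ϖ ζ g r) (n : ℕ) :
    ϖ ^ n * ζ = (ζ : D) ^ r ^ n * ϖ ^ n := by
  induction n with
  | zero => simp
  | succ n ih => rw [pow_succ', mul_assoc, ih, ← mul_assoc, h.uniformizer_mul_pow, mul_assoc, pow_succ' r]

theorem toGal_pow_apply (h : IsMonomialPair F ϖ ζ g r) (n : ℕ) :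
    (toGal (residueConj F h.isUniformizer.ne_zero) ^ n) (g : ResidueField F D) =
      (g : ResidueField F D) ^ r ^ n := by
  rw [residueConj_pow, ← h.residue_eq, residueConj_residue, ← map_pow]
  refine congrArg _ (Subtype.ext ?_)
  rw [coe_conjIntegers, h.uniformizer_pow_mul, mul_inv_cancel_right₀ (pow_ne_zero n h.isUniformizer.ne_zero),
    Subring.coe_pow]

theorem toGal_pow_eq_one_iff (h : IsMonomialPair F ϖ ζ g r) (n : ℕ) :
    toGal (residueConj F h.isUniformizer.ne_zero) ^ n = 1 ↔ ϖ ^ n * ζ = ζ * ϖ ^ n := by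
  constructor
  · intro hn
    have h1 := h.toGal_pow_apply n
    rw [hn, AlgEquiv.one_apply] at h1
    have h2 := h.pow_eq_pow (i := r ^ n) (j := 1) (Units.ext (by
      rw [Units.val_pow_eq_pow_val, ← h1, pow_one]))
    rw [h.uniformizer_pow_mul, ← Subring.coe_pow, h2, pow_one]
  · intro hn
    have h1 : (ζ : D) ^ r ^ n = ζ := mul_right_cancel₀
      (pow_ne_zero n h.isUniformizer.ne_zero) ((h.uniformizer_pow_mul n).symm.trans hn)
    have h2 : (g : ResidueField F D) ^ r ^ n = g := by
      rw [← h.residue_eq, ← map_pow]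
      exact congrArg _ (Subtype.ext (by rw [Subring.coe_pow, h1]))
    ext a
    rw [AlgEquiv.one_apply]
    obtain rfl | ⟨j, rfl⟩ := h.exists_pow a
    · rw [map_zero]
    · rw [map_pow, h.toGal_pow_apply, h2]

theorem fixedDegree_dvd_iff (h : IsMonomialPair F ϖ ζ g r) (n : ℕ) :
    fixedDegree (residueConj F h.isUniformizer.ne_zero) ∣ n ↔ ϖ ^ n * ζ = ζ * ϖ ^ n := by
  rw [← h.toGal_pow_eq_one_iff, ← orderOf_toGal, orderOf_dvd_iff_pow_eq_one]

end IsMonomialPair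

/-- Average: `∑ ζ^(-r * j) * ϖ * ζ^j`, over `j` modulo the order of `ζ`, intertwines `ζ` with `ζ ^
r`. It is again a uniformizer: it equals `U * ϖ`, where `U` reduces to `|k| - 1 = -1`. -/
theorem IsUniformizer.exists_isMonomialPair [TopologicalSpace D] [IsModuleTopology F D]
    (hϖ : IsUniformizer F ϖ) : ∃ ϖ' ζ g r, IsMonomialPair F (D := D) ϖ' ζ g r := by
  obtain ⟨g, hg⟩ := IsCyclic.exists_generator (α := (ResidueField F D)ˣ)
  obtain ⟨ζ, hζg, hζ⟩ := hϖ.exists_pow_card_eq (g : ResidueField F D)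
  have hM : orderOf g + 1 = Nat.card (ResidueField F D) := by
    rw [orderOf_eq_card_of_forall_mem_zpowers hg, Nat.card_units]
    exact Nat.sub_add_cancel Nat.card_pos
  have hMpos : 0 < orderOf g := orderOf_pos g
  have hζ0 : (ζ : D) ≠ 0 := by
    intro h0
    have h1 : ζ = 0 := Subtype.ext h0
    rw [h1, map_zero] at hζg
    exact g.ne_zero hζg.symm
  have hζM : ζ ^ orderOf g = 1 := by
    apply Subtype.ext
    apply mul_right_cancel₀ hζ0
    rw [← Subring.coe_mul, ← pow_succ, hM, hζ, Subring.coe_one, one_mul]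
  obtain ⟨r, hr⟩ : ∃ r : ℕ, residueConj F hϖ.ne_zero g = (g : ResidueField F D) ^ r := by
    obtain ⟨r, hr⟩ := mem_powers_iff_mem_zpowers.2 (hg (Units.mk0 (residueConj F hϖ.ne_zero g)
      ((map_ne_zero _).2 g.ne_zero)))
    exact ⟨r, by simpa using (congrArg Units.val hr).symm⟩
  set e := ζ ^ (orderOf g - 1) with he
  have hζe : ζ * e = 1 := by rw [he, ← pow_succ', Nat.sub_add_cancel hMpos, hζM]
  have heg : residue F D e * g = 1 := by
    rw [he, map_pow, hζg, ← pow_succ, Nat.sub_add_cancel hMpos, ← Units.val_pow_eq_pow_val,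
      pow_orderOf_eq_one, Units.val_one]
  let u : ℕ → ringOfIntegers F D := fun j => e ^ (r * j) * conjIntegers F hϖ.ne_zero (ζ ^ j)
  have huϖ : ∀ j, (u j : D) * ϖ = (e : D) ^ (r * j) * (ϖ * (ζ : D) ^ j) := by
    intro j
    simp only [u, Subring.coe_mul, coe_conjIntegers, Subring.coe_pow]
    rw [mul_assoc, inv_mul_cancel_right₀ hϖ.ne_zero]
  have hu : ∀ j, residue F D (u j) = 1 := by
    intro j
    rw [map_mul, ← residueConj_residue, map_pow _ ζ, map_pow _ e, hζg,
      map_pow (residueConj F hϖ.ne_zero), hr, ← pow_mul, ← mul_pow,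
      heg, one_pow]
  have hstep : ∀ j, (ζ : D) ^ r * ((u (j + 1) : D) * ϖ) = (u j : D) * ϖ * ζ := by
    intro j
    have h1 : (ζ : D) ^ r * (e : D) ^ (r * (j + 1)) = (e : D) ^ (r * j) := by
      have h2 : ζ ^ r * e ^ (r * (j + 1)) = e ^ (r * j) := by
        have h3 : Commute ζ e := Commute.self_pow ζ _
        rw [mul_add, mul_one, add_comm, pow_add, ← mul_assoc, ← h3.mul_pow, hζe, one_pow, one_mul]
      simpa using congrArg (Subring.subtype _) h2
    rw [huϖ, huϖ, ← mul_assoc, h1, pow_succ]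
    simp only [mul_assoc]
  set U := ∑ j ∈ Finset.range (orderOf g), u j with hU
  have hUϖ : (U : D) * ϖ = ∑ j ∈ Finset.range (orderOf g), (u j : D) * ϖ := by
    rw [hU, ← Finset.sum_mul]
    congr 1
    exact map_sum (Subring.subtype _) _ _
  have hUres : residue F D U ≠ 0 := by
    rw [hU, map_sum, Finset.sum_congr rfl fun j _ => hu j, Finset.sum_const, Finset.card_range,
      nsmul_one]
    intro h0
    have := Fintype.ofFinite (ResidueField F D)
    have h1 := FiniteField.cast_card_eq_zero (ResidueField F D)
    rw [← Nat.card_eq_fintype_card, ← hM, Nat.cast_add, h0, zero_add, Nat.cast_one] at h1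
    exact one_ne_zero h1
  have hval : normValuation F (U : D) = 1 :=
    le_antisymm U.2 (not_lt.1 fun h => hUres (residue_eq_zero_iff.2 h))
  refine ⟨U * ϖ, ζ, g, r, hϖ.of_normValuation_eq (by rw [map_mul, hval, one_mul]), hζg, hg, hζM, ?_⟩
  rw [hUϖ, Finset.sum_mul, Finset.mul_sum, ← Finset.sum_congr rfl fun j _ => hstep j]
  -- Splitting off the last or the first term shows that the cyclic shift leaves the sum unchanged.
  have h1 := Finset.sum_range_succ (fun j => (ζ : D) ^ r * ((u j : D) * ϖ)) (orderOf g)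
  have h2 := Finset.sum_range_succ' (fun j => (ζ : D) ^ r * ((u j : D) * ϖ)) (orderOf g)
  have h3 : (u (orderOf g) : D) * ϖ = (u 0 : D) * ϖ := by
    have h4 : e ^ orderOf g = 1 := by rw [he, ← pow_mul, mul_comm, pow_mul, hζM, one_pow]
    have h5 : e ^ (r * orderOf g) = 1 := by rw [mul_comm, pow_mul, h4, one_pow]
    have h6 : u (orderOf g) = u 0 := by
      simp only [u]
      rw [h5, hζM, mul_zero, pow_zero, pow_zero]
    rw [h6]
  rw [h2, h3] at h1
  exact add_right_cancel h1

namespace IsMonomialPair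

variable [TopologicalSpace D] [IsModuleTopology F D] [Algebra.IsCentral F D]

/-- The centralizer of `x` is closed and contains all `ζ ^ j * ϖ ^ n`, hence `𝒪_D`, hence `D` after
scaling. -/
theorem exists_algebraMap_eq (h : IsMonomialPair F ϖ ζ g r) {x : D} (h1 : ϖ * x = x * ϖ)
    (h2 : (ζ : D) * x = x * ζ) : ∃ t : F, algebraMap F D t = x := by
  have := isTopologicalRing F D
  have := t2Space F D
  have hϖ : ϖ ∈ Subring.centralizer {x} :=
    Subring.mem_centralizer_iff.2 fun y hy => by rw [Set.mem_singleton_iff.1 hy, h1]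
  have hζ : (ζ : D) ∈ Subring.centralizer {x} :=
    Subring.mem_centralizer_iff.2 fun y hy => by rw [Set.mem_singleton_iff.1 hy, h2]
  have hO : ∀ y ∈ ringOfIntegers F D, y ∈ (Subring.centralizer {x}).toAddSubgroup := fun y hy =>
    h.isUniformizer.integers_le_of_isClosed (Set.isClosed_centralizer {x}) (fun a n => by
      obtain rfl | ⟨j, rfl⟩ := h.exists_pow a
      · exact ⟨0, map_zero _, by simp⟩
      · exact ⟨ζ ^ j, by rw [map_pow, h.residue_eq], (Subring.centralizer {x}).mul_mem
          (pow_mem hζ j) (pow_mem hϖ n)⟩) hy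
  have hc : x ∈ Subalgebra.center F D := by
    rw [Subalgebra.mem_center_iff]
    intro y
    obtain ⟨t, ht, hty⟩ := exists_smul_mem_ringOfIntegers F y
    have h3 := Subring.mem_centralizer_iff.1 (hO _ hty) x rfl
    rw [mul_smul_comm, smul_mul_assoc] at h3
    exact (smul_right_injective D ht h3).symm
  exact Algebra.mem_bot.1 (Algebra.IsCentral.out hc)

/-- If `c ≠ 0` is the residue of `ζ ^ j`, then `ζ ^ j * ϖ ^ (s * m)` commutes with `ϖ` because `σ c
= c`, and with `ζ` because `σ ^ s = 1`. -/
theorem exists_central_lift (h : IsMonomialPair F ϖ ζ g r) (m : ℕ) {c : ResidueField F D}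
    (hc : residueConj F h.isUniformizer.ne_zero c = c) :
    ∃ (t : F) (u : ringOfIntegers F D), residue F D u = c ∧ algebraMap F D t =
      u * ϖ ^ (fixedDegree (residueConj F h.isUniformizer.ne_zero) * m) := by
  set s := fixedDegree (residueConj F h.isUniformizer.ne_zero) with hs
  have hcomm : ϖ ^ (s * m) * ζ = ζ * ϖ ^ (s * m) :=
    (h.fixedDegree_dvd_iff _).1 (dvd_mul_right s m)
  obtain rfl | ⟨j, rfl⟩ := h.exists_pow c
  · exact ⟨0, 0, map_zero _, by simp⟩
  · have hj : ϖ * (ζ : D) ^ j = (ζ : D) ^ j * ϖ := by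
      have h1 := h.toGal_pow_apply 1
      rw [pow_one, pow_one, toGal_apply] at h1
      rw [map_pow, h1, ← pow_mul] at hc
      have h2 := h.pow_eq_pow (i := r * j) (j := j) (Units.ext (by simpa using hc))
      rw [h.uniformizer_mul_pow, ← Subring.coe_pow, h2, Subring.coe_pow]
    obtain ⟨t, ht⟩ := h.exists_algebraMap_eq (x := (ζ : D) ^ j * ϖ ^ (s * m))
      (by rw [← mul_assoc, hj, mul_assoc, mul_assoc, ← pow_succ', ← pow_succ])
      (by rw [mul_assoc, hcomm, ← mul_assoc, ← mul_assoc, ← pow_succ', ← pow_succ])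
    exact ⟨t, ζ ^ j, by rw [map_pow, h.residue_eq], ht⟩

/-- Take `m = [D : K]` for `K = F(ζ)`. Conjugation by `ϖ` is an automorphism of `K` of order `s`
with fixed field `F`, so `[K : F] = s`; and `m ≤ s` since `ϖ ^ s` is central. -/
theorem exists_fixedDegree_mul_eq_finrank (h : IsMonomialPair F ϖ ζ g r) :
    ∃ m ≤ fixedDegree (residueConj F h.isUniformizer.ne_zero),
      fixedDegree (residueConj F h.isUniformizer.ne_zero) * m = Module.finrank F D := by
  set s := fixedDegree (residueConj F h.isUniformizer.ne_zero) with hs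
  have hϖ0 := h.isUniformizer.ne_zero
  obtain ⟨K, _, _, _, f, z, hz, hadj⟩ := exists_field_adjoin (F := F) (ζ : D)
  have hf : Function.Injective f := f.toRingHom.injective
  let c : D →ₐ[F] D :=
    { toFun := fun y => ϖ * y * ϖ⁻¹
      map_one' := by rw [mul_one, mul_inv_cancel₀ hϖ0]
      map_zero' := by rw [mul_zero, zero_mul]
      map_add' := fun x y => by rw [mul_add, add_mul]
      map_mul' := fun x y => by simp only [mul_assoc, inv_mul_cancel_left₀ hϖ0]
      commutes' := fun t => by rw [← Algebra.commutes, mul_inv_cancel_right₀ hϖ0] }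
  have hcz : c (f z) = f (z ^ r) := by
    rw [map_pow, hz]
    change ϖ * (ζ : D) * ϖ⁻¹ = _
    rw [h.mul_eq, mul_inv_cancel_right₀ hϖ0]
  have hrange : ∀ x, (c.comp f) x ∈ f.range := by
    intro x
    have hx : x ∈ Algebra.adjoin F {z} := hadj ▸ Algebra.mem_top
    have h1 : Algebra.adjoin F {z} ≤ f.range.comap (c.comp f) := Algebra.adjoin_le
      (Set.singleton_subset_iff.2 ⟨z ^ r, hcz.symm⟩)
    exact h1 hx
  let φ₀ : K →ₐ[F] K := (AlgEquiv.ofInjective f hf).symm.toAlgHom.comp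
    ((c.comp f).codRestrict f.range hrange)
  let φ : Gal(K/F) := AlgEquiv.ofBijective φ₀ φ₀.bijective
  have hφ : ∀ x, f (φ x) = ϖ * f x * ϖ⁻¹ := fun x =>
    congrArg Subtype.val ((AlgEquiv.ofInjective f hf).apply_symm_apply
      (((c.comp f).codRestrict f.range hrange) x))
  have hφn : ∀ (n : ℕ) x, f ((φ ^ n) x) = ϖ ^ n * f x * (ϖ ^ n)⁻¹ := by
    intro n x
    induction n with
    | zero => simp
    | succ n ih =>
      rw [pow_succ', AlgEquiv.mul_apply, hφ, ih, pow_succ', mul_inv_rev]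
      simp only [mul_assoc]
  have hord : orderOf φ = s := by
    rw [hs, ← orderOf_toGal, orderOf_eq_orderOf_iff]
    intro n
    rw [h.toGal_pow_eq_one_iff, ← hz]
    have hn0 := pow_ne_zero n hϖ0
    constructor
    · intro hn
      have h1 := hφn n z
      rw [hn, AlgEquiv.one_apply, eq_mul_inv_iff_mul_eq₀ hn0] at h1
      exact h1.symm
    · intro hn
      have h1 : (φ ^ n) z = z := hf (by
        rw [hφn, hn, mul_inv_cancel_right₀ hn0])
      have h2 : ((φ ^ n : Gal(K/F)) : K →ₐ[F] K) = AlgHom.id F K :=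
        AlgHom.ext_of_adjoin_eq_top hadj fun y hy => by
          rw [Set.mem_singleton_iff.1 hy]
          exact h1
      ext x
      exact DFunLike.congr_fun h2 x
  have hfix : IntermediateField.fixedField (Subgroup.zpowers φ) = ⊥ := by
    rw [eq_bot_iff]
    intro x hx
    have hx1 : φ x = x :=
      (IntermediateField.mem_fixedField_iff _ _).1 hx φ (Subgroup.mem_zpowers φ)
    obtain ⟨t, ht⟩ := h.exists_algebraMap_eq (x := f x)
      (by
        have h1 := hφ x
        rw [hx1, eq_mul_inv_iff_mul_eq₀ hϖ0] at h1
        exact h1.symm)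
      (by rw [← hz, ← map_mul, mul_comm, map_mul])
    exact IntermediateField.mem_bot.2 ⟨t, hf (by rw [AlgHom.commutes, ht])⟩
  have hKs : Module.finrank F K = s := by
    have h1 := IntermediateField.finrank_fixedField_eq_card (Subgroup.zpowers φ)
    rw [hfix, IntermediateField.finrank_bot', Nat.card_zpowers, hord] at h1
    exact h1
  let : Module K D := Module.compHom D f.toRingHom
  have hsm : ∀ (k : K) (y : D), k • y = f k * y := fun _ _ => rfl
  have : IsScalarTower F K D := ⟨fun a k y => by
    rw [hsm, hsm, map_smul, smul_mul_assoc]⟩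
  have : FiniteDimensional K D := FiniteDimensional.right F K D
  refine ⟨Module.finrank K D, ?_, by rw [← hKs, Module.finrank_mul_finrank]⟩
  have hspos : 0 < s := hKs ▸ Module.finrank_pos
  obtain ⟨π, hπ⟩ := h.exists_algebraMap_eq (x := ϖ ^ s) (by rw [← pow_succ', ← pow_succ])
    (by rw [(h.fixedDegree_dvd_iff s).1 dvd_rfl])
  have hπ1 : valuation F π ≤ 1 := by
    rw [← normValuation_algebraMap_le_one F (D := D), hπ, map_pow]
    exact pow_le_one₀ zero_le h.isUniformizer.normValuation_lt_one.le
  -- The range is compact, hence closed, and contains `ζ ^ j * ϖ ^ n = π ^ (n / s) * ζ ^ j * ϖ ^ (n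
  -- % s)`; so it contains `𝒪_D`.
  let Λ : (Fin s × Fin (orderOf g) → 𝒪[F]) →+ D :=
    { toFun := fun a => ∑ i, algebraMap F D (a i) * ((ζ : D) ^ (i.2 : ℕ) * ϖ ^ (i.1 : ℕ))
      map_zero' := by simp
      map_add' := fun a b => by simp [add_mul, Finset.sum_add_distrib] }
  have := isTopologicalRing F D
  have := t2Space F D
  have hΛc : Continuous Λ := by
    refine continuous_finsetSum _ fun i _ => Continuous.mul ?_ continuous_const
    exact (IsModuleTopology.continuous_of_linearMap (Algebra.linearMap F D)).comp
      (continuous_subtype_val.comp (continuous_apply i))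
  have hΛcl : IsClosed (Λ.range : Set D) := by
    rw [AddMonoidHom.coe_range]
    exact (isCompact_range hΛc).isClosed
  have hO : ∀ y ∈ ringOfIntegers F D, y ∈ Λ.range := fun y hy =>
    h.isUniformizer.integers_le_of_isClosed hΛcl (fun a n => by
      obtain rfl | ⟨j, rfl⟩ := h.exists_pow a
      · exact ⟨0, map_zero _, by simp [zero_mem]⟩
      · refine ⟨ζ ^ j, by rw [map_pow, h.residue_eq], ?_⟩
        let i₀ : Fin s × Fin (orderOf g) :=
          (⟨n % s, Nat.mod_lt _ hspos⟩, ⟨j % orderOf g, Nat.mod_lt _ (orderOf_pos g)⟩)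
        refine ⟨Pi.single i₀ (⟨π, hπ1⟩ ^ (n / s)), ?_⟩
        change ∑ i, _ = _
        rw [Finset.sum_eq_single i₀ (fun i _ hi => by simp [hi]) (by simp)]
        have h1 : (ζ : D) ^ (j % orderOf g) = (ζ : D) ^ j := by
          rw [← Subring.coe_pow, ← Subring.coe_pow, ← pow_eq_pow_mod j h.pow_orderOf]
        rw [Pi.single_eq_same]
        change algebraMap F D (π ^ (n / s)) * ((ζ : D) ^ (j % orderOf g) * ϖ ^ (n % s)) =
          ((ζ ^ j : ringOfIntegers F D) : D) * ϖ ^ n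
        rw [h1, ← mul_assoc, Algebra.commutes, mul_assoc, map_pow, hπ, ← pow_mul, ← pow_add,
          Nat.div_add_mod, Subring.coe_pow]) hy
  have hspan : Submodule.span K (Set.range fun i : Fin s => ϖ ^ (i : ℕ)) = ⊤ := by
    rw [eq_top_iff]
    intro y _
    obtain ⟨t, ht, hty⟩ := exists_smul_mem_ringOfIntegers F y
    have h1 : t • y ∈ Submodule.span K (Set.range fun i : Fin s => ϖ ^ (i : ℕ)) := by
      obtain ⟨a, ha⟩ := hO _ hty
      rw [← ha]
      refine Submodule.sum_mem _ fun i _ => ?_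
      have h2 : algebraMap F D (a i) * ((ζ : D) ^ (i.2 : ℕ) * ϖ ^ (i.1 : ℕ)) =
          (algebraMap F K (a i) * z ^ (i.2 : ℕ)) • ϖ ^ (i.1 : ℕ) := by
        rw [hsm, map_mul, map_pow, AlgHom.commutes, hz, mul_assoc]
      rw [h2]
      exact Submodule.smul_mem _ _ (Submodule.subset_span ⟨i.1, rfl⟩)
    have h3 : y = algebraMap F K t⁻¹ • (t • y) := by
      rw [hsm, AlgHom.commutes, ← Algebra.smul_def, smul_smul, inv_mul_cancel₀ ht, one_smul]
    rw [h3]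
    exact Submodule.smul_mem _ _ h1
  simpa using finrank_le_of_span_eq_top hspan

end IsMonomialPair

end MonomialPair

/-! ### Calculus of leading coefficients -/

section LeadingCoeff

variable {F D : Type*} [Field F] [ValuativeRel F] [TopologicalSpace F]
  [IsNonarchimedeanLocalField F] [DivisionRing D] [Algebra F D] [FiniteDimensional F D]

variable (F) in
/-- `x = u * ϖ ^ n` with `u ∈ 𝒪_D` reducing to `c`. -/
def HasLeadingCoeff (ϖ : D) (n : ℕ) (x : D) (c : ResidueField F D) : Prop :=
  ∃ u : ringOfIntegers F D, x = u * ϖ ^ n ∧ residue F D u = c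

variable {ϖ : D} {n m : ℕ} {x y : D} {a b : ResidueField F D}

theorem leadingCoeffEq_iff {g : Dˣ} :
    LeadingCoeffEq F ϖ n g a ↔ HasLeadingCoeff F ϖ n ((g : D) - 1) a := by
  simp only [LeadingCoeffEq, HasLeadingCoeff, sub_eq_iff_eq_add']

theorem HasLeadingCoeff.add (hx : HasLeadingCoeff F ϖ n x a) (hy : HasLeadingCoeff F ϖ n y b) :
    HasLeadingCoeff F ϖ n (x + y) (a + b) := by
  obtain ⟨u, rfl, rfl⟩ := hx
  obtain ⟨v, rfl, rfl⟩ := hy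
  exact ⟨u + v, by rw [Subring.coe_add, add_mul], map_add _ _ _⟩

theorem HasLeadingCoeff.neg (hx : HasLeadingCoeff F ϖ n x a) :
    HasLeadingCoeff F ϖ n (-x) (-a) := by
  obtain ⟨u, rfl, rfl⟩ := hx
  exact ⟨-u, by rw [Subring.coe_neg, neg_mul], map_neg _ _⟩

theorem HasLeadingCoeff.sub (hx : HasLeadingCoeff F ϖ n x a) (hy : HasLeadingCoeff F ϖ n y b) :
    HasLeadingCoeff F ϖ n (x - y) (a - b) := by
  rw [sub_eq_add_neg, sub_eq_add_neg]
  exact hx.add hy.neg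

theorem exists_hasLeadingCoeff (ϖ : D) (n : ℕ) (a : ResidueField F D) :
    ∃ x, HasLeadingCoeff F ϖ n x a := by
  obtain ⟨u, rfl⟩ := residue_surjective a
  exact ⟨_, u, rfl, rfl⟩

theorem normValuation_mul_le_pow (hx : normValuation F x ≤ normValuation F ϖ ^ n)
    (hy : normValuation F y ≤ normValuation F ϖ ^ m) :
    normValuation F (x * y) ≤ normValuation F ϖ ^ (n + m) := by
  rw [map_mul, pow_add]
  exact mul_le_mul' hx hy

theorem hasLeadingCoeff_one {ϖ : D} (hx : normValuation F (x - 1) < 1) : HasLeadingCoeff F ϖ 0 x 1 := by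
  have hx1 : x - 1 ∈ ringOfIntegers F D := hx.le
  have hxO : x ∈ ringOfIntegers F D := by
    have := add_mem hx1 (one_mem _)
    rwa [sub_add_cancel] at this
  refine ⟨⟨x, hxO⟩, by rw [pow_zero, mul_one], ?_⟩
  rw [← map_one (residue F D), residue_eq_iff]
  exact hx

namespace IsUniformizer

variable (hϖ : IsUniformizer F ϖ)
include hϖ

theorem normValuation_pow_le (h : m ≤ n) : normValuation F ϖ ^ n ≤ normValuation F ϖ ^ m :=
  pow_le_pow_right_of_le_one' hϖ.normValuation_lt_one.le h

theorem le_pow (hx : HasLeadingCoeff F ϖ n x a) : normValuation F x ≤ normValuation F ϖ ^ n := by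
  obtain ⟨u, rfl, -⟩ := hx
  exact hϖ.le_pow_iff.2 ⟨u, rfl⟩

theorem exists_hasLeadingCoeff_of_le (hx : normValuation F x ≤ normValuation F ϖ ^ n) :
    ∃ a, HasLeadingCoeff F ϖ n x a := by
  obtain ⟨u, rfl⟩ := hϖ.le_pow_iff.1 hx
  exact ⟨_, u, rfl, rfl⟩

theorem hasLeadingCoeff_zero_iff :
    HasLeadingCoeff F ϖ n x 0 ↔ normValuation F x ≤ normValuation F ϖ ^ (n + 1) := by
  constructor
  · rintro ⟨u, rfl, hu⟩
    exact (hϖ.mul_pow_le_iff u n).2 hu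
  · intro h
    obtain ⟨u, rfl⟩ := hϖ.le_pow_iff.1 (h.trans (hϖ.normValuation_pow_le n.le_succ))
    exact ⟨u, rfl, (hϖ.mul_pow_le_iff u n).1 h⟩

theorem hasLeadingCoeff_zero_of_lt (h : n < m) (hx : normValuation F x ≤ normValuation F ϖ ^ m) :
    HasLeadingCoeff F ϖ n x 0 :=
  hϖ.hasLeadingCoeff_zero_iff.2 (hx.trans (hϖ.normValuation_pow_le h))

theorem hasLeadingCoeff_mul [Finite (ResidueField F D)] (hx : HasLeadingCoeff F ϖ n x a)
    (hy : HasLeadingCoeff F ϖ m y b) {l : ℕ} (hl : n + m = l) :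
    HasLeadingCoeff F ϖ l (x * y) (a * (toGal (residueConj F hϖ.ne_zero) ^ n) b) := by
  obtain ⟨u, rfl, rfl⟩ := hx
  obtain ⟨v, rfl, rfl⟩ := hy
  refine ⟨u * conjIntegers F (pow_ne_zero n hϖ.ne_zero) v, ?_, ?_⟩
  · rw [Subring.coe_mul, coe_conjIntegers, ← hl, pow_add]
    simp only [mul_assoc]
    rw [inv_mul_cancel_left₀ (pow_ne_zero n hϖ.ne_zero)]
  · rw [residueConj_pow, residueConj_residue, map_mul]

end IsUniformizer

theorem normValuation_eq_one_of_sub_one_lt (hx : normValuation F (x - 1) < 1) :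
    normValuation F x = 1 := by
  have h := (normValuation F).map_one_add_of_lt hx
  rwa [add_sub_cancel] at h

theorem ne_zero_of_sub_one_lt (hx : normValuation F (x - 1) < 1) : x ≠ 0 := by
  rintro rfl
  have := normValuation_eq_one_of_sub_one_lt hx
  rw [map_zero] at this
  exact zero_ne_one this

theorem normValuation_inv_sub_one_lt (hx : normValuation F (x - 1) < 1) :
    normValuation F (x⁻¹ - 1) < 1 := by
  have h0 := ne_zero_of_sub_one_lt hx
  have h1 : x⁻¹ - 1 = -(x⁻¹ * (x - 1)) := by rw [mul_sub, inv_mul_cancel₀ h0, mul_one, neg_sub]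
  rw [h1, Valuation.map_neg, map_mul, map_inv₀, normValuation_eq_one_of_sub_one_lt hx, inv_one,
    one_mul]
  exact hx

theorem IsUniformizer.mem_congruenceSubgroup_iff (hϖ : IsUniformizer F ϖ) {g : Dˣ} :
    g ∈ congruenceSubgroup F ϖ n ↔ normValuation F ((g : D) - 1) ≤ normValuation F ϖ ^ n := by
  rw [hϖ.le_pow_iff']
  simp only [congruenceSubgroup, Set.mem_ofPred_eq, sub_eq_iff_eq_add']

theorem IsUniformizer.mem_congruenceSubgroup_one_iff (hϖ : IsUniformizer F ϖ) {g : Dˣ} :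
    g ∈ congruenceSubgroup F ϖ 1 ↔ normValuation F ((g : D) - 1) < 1 := by
  rw [hϖ.mem_congruenceSubgroup_iff, pow_one, hϖ.lt_one_iff]

theorem IsUniformizer.congruenceSubgroup_eq {ϖ' : D} (hϖ : IsUniformizer F ϖ)
    (hϖ' : IsUniformizer F ϖ') : congruenceSubgroup F ϖ = congruenceSubgroup F ϖ' := by
  have h : normValuation F ϖ = normValuation F ϖ' :=
    le_antisymm (hϖ'.lt_one_iff.1 hϖ.normValuation_lt_one)
      (hϖ.lt_one_iff.1 hϖ'.normValuation_lt_one)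
  funext n
  ext g
  rw [hϖ.mem_congruenceSubgroup_iff, hϖ'.mem_congruenceSubgroup_iff, h]

variable [Finite (ResidueField F D)]

/-- `[x, y] - 1 = (x * y - y * x) * x⁻¹ * y⁻¹`, and `x * y - y * x` is the additive commutator of `x
- 1` and `y - 1`. -/
theorem IsUniformizer.hasLeadingCoeff_commutator (hϖ : IsUniformizer F ϖ)
    (hx : HasLeadingCoeff F ϖ 1 (x - 1) a) (hy : HasLeadingCoeff F ϖ 1 (y - 1) b) :
    HasLeadingCoeff F ϖ 2 (x * y * x⁻¹ * y⁻¹ - 1)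
      (a * residueConj F hϖ.ne_zero b - b * residueConj F hϖ.ne_zero a) := by
  have hlt : ∀ {x : D} {a}, HasLeadingCoeff F ϖ 1 (x - 1) a → normValuation F (x - 1) < 1 :=
    fun h => hϖ.lt_one_iff.2 (by simpa using hϖ.le_pow h)
  have hx0 := ne_zero_of_sub_one_lt (hlt hx)
  have hy0 := ne_zero_of_sub_one_lt (hlt hy)
  have h1 := (hϖ.hasLeadingCoeff_mul hx hy one_add_one_eq_two).sub
    (hϖ.hasLeadingCoeff_mul hy hx one_add_one_eq_two)
  have h2 := hϖ.hasLeadingCoeff_mul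
    (hasLeadingCoeff_one (ϖ := ϖ) (normValuation_inv_sub_one_lt (hlt hx)))
    (hasLeadingCoeff_one (ϖ := ϖ) (normValuation_inv_sub_one_lt (hlt hy))) (zero_add 0)
  have h3 := hϖ.hasLeadingCoeff_mul h1 h2 (add_zero 2)
  rw [map_one, mul_one, map_one, mul_one] at h3
  convert! h3 using 1
  have h4 : (x - 1) * (y - 1) - (y - 1) * (x - 1) = x * y - y * x := by noncomm_ring
  rw [h4, sub_mul, ← mul_assoc, ← mul_assoc (y * x), mul_inv_cancel_right₀ hx0, mul_inv_cancel₀ hy0]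

theorem exists_residue_pair {p : ℕ} [Fact p.Prime] [CharP (ResidueField F D) p]
    {σ : ResidueField F D ≃+* ResidueField F D} (hs : 5 ≤ fixedDegree σ)
    (hps : ¬ p ∣ fixedDegree σ) {α : ResidueField F D} (hα : α ≠ 0) :
    ∃ a b, a ≠ 0 ∧ b ≠ 0 ∧ a * σ b - b * σ a = α ∧
      ∀ K : Subfield (ResidueField F D), a / b ∈ K → K = ⊤ := by
  obtain ⟨b, c, hb, h, hK⟩ := exists_mul_map_mul_sub_eq (zpowers_toGal σ) hs hps hα
  have hc : c ≠ 0 := by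
    rintro rfl
    rw [map_zero, sub_zero, mul_zero] at h
    exact hα h.symm
  refine ⟨c * b, b, mul_ne_zero hc hb, hb, ?_, fun K hcK => hK K ?_⟩
  · rw [← h, map_mul, toGal_apply, toGal_apply]
    ring
  · rwa [mul_div_cancel_right₀ _ hb] at hcK

/-- The fixed field of `σ ^ (n + 1)` contains the generator `a / b` only if `σ ^ (n + 1) = 1`. Only
in those degrees is a central correction `h` needed, and there it can be lifted to `F`. -/
theorem exists_residue_correction {p : ℕ} [Fact p.Prime] [CharP (ResidueField F D) p]
    {σ : ResidueField F D ≃+* ResidueField F D} (hps : ¬ p ∣ fixedDegree σ)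
    (ha : a ≠ 0) (hb : b ≠ 0) (hab : ∀ K : Subfield (ResidueField F D), a / b ∈ K → K = ⊤)
    (n : ℕ) (e : ResidueField F D) :
    ∃ u v h, σ h = h ∧ (h = 0 ∨ fixedDegree σ ∣ n + 1) ∧
      a * σ v - v * (toGal σ ^ n) a + (u * (toGal σ ^ n) b - b * σ u) + h = e := by
  by_cases hn : fixedDegree σ ∣ n + 1
  · have h1 : toGal σ ^ (n + 1) = 1 := by rwa [← orderOf_dvd_iff_pow_eq_one, orderOf_toGal]
    obtain ⟨u, v, h, hσ, heq⟩ := exists_commutator_correction_add (zpowers_toGal σ) hps b ha h1 e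
    exact ⟨u, v, h, hσ, Or.inr hn, heq⟩
  · obtain ⟨u, v, heq⟩ := exists_commutator_correction (zpowers_toGal σ) ha hb (n := n) (by
      intro h
      apply hn
      rw [← orderOf_toGal, orderOf_dvd_iff_pow_eq_one]
      have h1 := hab (fixedSubfield (toGal σ ^ (n + 1)).toRingEquiv) h
      ext x
      have h2 : x ∈ fixedSubfield (toGal σ ^ (n + 1)).toRingEquiv :=
        h1 ▸ Subfield.mem_top x
      exact h2) e
    exact ⟨u, v, 0, map_zero σ, Or.inl rfl, by rw [add_zero]; exact heq⟩

end LeadingCoeff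

/-! ### Successive approximation of `g` by a commutator times a central element -/

section Commutators

variable {F D : Type*} [Field F] [ValuativeRel F] [TopologicalSpace F]
  [IsNonarchimedeanLocalField F] [DivisionRing D] [Algebra F D] [FiniteDimensional F D]

theorem charP_residueField (F D : Type*) [Field F] [ValuativeRel F] [TopologicalSpace F]
    [IsNonarchimedeanLocalField F] [DivisionRing D] [Algebra F D] [FiniteDimensional F D]
    (p : ℕ) [Fact p.Prime] [CharP 𝓀[F] p] : CharP (ResidueField F D) p := by
  have hv : valuation F (p : F) < 1 := by
    by_contra! h
    have hle : valuation F (p : F) ≤ 1 := (p : 𝒪[F]).2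
    have h1 : valuation F (p : F) = 1 := le_antisymm hle h
    have h0 : (p : F) ≠ 0 := by
      intro h0
      rw [h0, map_zero] at h1
      exact zero_ne_one h1
    have hu : IsUnit (p : 𝒪[F]) := by
      refine IsUnit.of_mul_eq_one (⟨(p : F)⁻¹, ?_⟩ : 𝒪[F]) (Subtype.ext ?_)
      · change valuation F (p : F)⁻¹ ≤ 1
        rw [map_inv₀, h1, inv_one]
      · exact mul_inv_cancel₀ h0
    have h2 := hu.map (IsLocalRing.residue 𝒪[F])
    rw [map_natCast, CharP.cast_eq_zero] at h2
    exact not_isUnit_zero h2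
  have h0 : (p : ResidueField F D) = 0 := by
    rw [← map_natCast (residue F D), residue_eq_zero_iff]
    have h1 := (normValuation_algebraMap_lt_one F (D := D)).2 hv
    rw [map_natCast] at h1
    simpa using h1
  obtain ⟨q, hq⟩ := CharP.exists (ResidueField F D)
  have h1 : q ∣ p := (CharP.cast_eq_zero_iff _ q p).1 h0
  rcases (Nat.dvd_prime (Fact.out : p.Prime)).1 h1 with rfl | rfl
  · exact absurd rfl (CharP.char_ne_one (ResidueField F D) 1)
  · exact hq

theorem IsUniformizer.le_fixedDegree_and_not_dvd [Finite (ResidueField F D)]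
    [TopologicalSpace D] [IsModuleTopology F D] [Algebra.IsCentral F D] {ϖ : D}
    (hϖ : IsUniformizer F ϖ) {d p : ℕ} [Fact p.Prime] (hdim : Module.finrank F D = d ^ 2)
    (hp : p.Coprime d) : d ≤ fixedDegree (residueConj F hϖ.ne_zero) ∧
      ¬ p ∣ fixedDegree (residueConj F hϖ.ne_zero) := by
  obtain ⟨ϖ', ζ, g, r, h⟩ := hϖ.exists_isMonomialPair
  rw [hϖ.residueConj_eq h.isUniformizer]
  obtain ⟨m, hm, hsm⟩ := h.exists_fixedDegree_mul_eq_finrank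
  rw [hdim] at hsm
  constructor
  · refine (Nat.pow_le_pow_iff_left two_ne_zero).1 ?_
    rw [← hsm, pow_two]
    exact Nat.mul_le_mul_left _ hm
  · intro hdvd
    have h1 : p ∣ d ^ 2 := hsm ▸ hdvd.mul_right m
    have h2 := (Fact.out : p.Prime).dvd_of_dvd_pow h1
    exact (Fact.out : p.Prime).one_lt.ne' (Nat.eq_one_of_dvd_coprimes hp dvd_rfl h2)

variable [Finite (ResidueField F D)] {ϖ : D}

theorem IsUniformizer.hasLeadingCoeff_perturbation (hϖ : IsUniformizer F ϖ) {n : ℕ} (hn : 2 ≤ n)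
    {x y c g δ ε η : D} {a b u v h e : ResidueField F D}
    (hx : HasLeadingCoeff F ϖ 1 (x - 1) a) (hy : HasLeadingCoeff F ϖ 1 (y - 1) b)
    (hc : normValuation F (c - 1) ≤ normValuation F ϖ ^ 2)
    (hg : normValuation F (g - 1) ≤ normValuation F ϖ ^ 2)
    (hδ : HasLeadingCoeff F ϖ n δ u) (hε : HasLeadingCoeff F ϖ n ε v)
    (hη : HasLeadingCoeff F ϖ (n + 1) η h)
    (hE : HasLeadingCoeff F ϖ (n + 1) (x * y * c - g * y * x) e) :
    HasLeadingCoeff F ϖ (n + 1) ((x + δ) * (y + ε) * (c + η) - g * (y + ε) * (x + δ))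
      (e + (a * residueConj F hϖ.ne_zero v - v * (toGal (residueConj F hϖ.ne_zero) ^ n) a +
        (u * (toGal (residueConj F hϖ.ne_zero) ^ n) b - b * residueConj F hϖ.ne_zero u) + h)) := by
  have hlt : ∀ {x : D} {a}, HasLeadingCoeff F ϖ 1 (x - 1) a → normValuation F (x - 1) < 1 :=
    fun h => hϖ.lt_one_iff.2 (by simpa using hϖ.le_pow h)
  have hlt2 : ∀ {x : D}, normValuation F (x - 1) ≤ normValuation F ϖ ^ 2 →
      normValuation F (x - 1) < 1 := fun h =>
    h.trans_lt (pow_lt_one₀ zero_le hϖ.normValuation_lt_one two_ne_zero)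
  have hv : ∀ {x : D}, normValuation F (x - 1) < 1 → normValuation F x ≤ normValuation F ϖ ^ 0 :=
    fun h => by rw [pow_zero, normValuation_eq_one_of_sub_one_lt h]
  have hx0 := hv (hlt hx)
  have hy0 := hv (hlt hy)
  have hc0 := hv (hlt2 hc)
  have hg0 := hv (hlt2 hg)
  have hδ0 := hϖ.le_pow hδ
  have hε0 := hϖ.le_pow hε
  have hη0 := hϖ.le_pow hη
  have hxy : normValuation F (x * y - 1) ≤ normValuation F ϖ ^ 1 := by
    have h1 : x * y - 1 = (x - 1) * y + (y - 1) := by noncomm_ring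
    rw [h1]
    refine (normValuation F).map_add_le ?_ (hϖ.le_pow hy)
    exact normValuation_mul_le_pow (hϖ.le_pow hx) hy0
  have small : ∀ {z : D} {m : ℕ}, n + 2 ≤ m → normValuation F z ≤ normValuation F ϖ ^ m →
      HasLeadingCoeff F ϖ (n + 1) z 0 := fun hm hz => hϖ.hasLeadingCoeff_zero_of_lt hm hz
  -- `r1` to `r10` are the terms of the expansion of degree at least `n + 2`; `2 ≤ n` makes `δ * ε`
  -- one of them. The terms `m1` to `m4`, together with `η`, carry the change in degree `n + 1`.
  have r1 := small (by omega) (normValuation_mul_le_pow (normValuation_mul_le_pow hx0 hε0) hc)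
  have r2 := small (by omega) (normValuation_mul_le_pow hg (normValuation_mul_le_pow hε0 hx0))
  have r3 := small (by omega) (normValuation_mul_le_pow (normValuation_mul_le_pow hδ0 hy0) hc)
  have r4 := small (by omega) (normValuation_mul_le_pow hg (normValuation_mul_le_pow hy0 hδ0))
  have r5 := small (by omega) (normValuation_mul_le_pow (normValuation_mul_le_pow hδ0 hε0) hc0)
  have r6 := small (by omega) (normValuation_mul_le_pow (normValuation_mul_le_pow hδ0 hε0) hη0)
  have r7 := small (by omega) (normValuation_mul_le_pow (normValuation_mul_le_pow hg0 hε0) hδ0)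
  have r8 := small (by omega) (normValuation_mul_le_pow hxy hη0)
  have r9 := small (by omega) (normValuation_mul_le_pow (normValuation_mul_le_pow hx0 hε0) hη0)
  have r10 := small (by omega) (normValuation_mul_le_pow (normValuation_mul_le_pow hδ0 hy0) hη0)
  have m1 := hϖ.hasLeadingCoeff_mul hx hε (add_comm 1 n)
  have m2 := hϖ.hasLeadingCoeff_mul hε hx rfl
  have m3 := hϖ.hasLeadingCoeff_mul hδ hy rfl
  have m4 := hϖ.hasLeadingCoeff_mul hy hδ (add_comm 1 n)
  have key := (hE.add (((m1.sub m2).add (m3.sub m4)).add hη)).add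
    ((((((((((r1.sub r2).add r3).sub r4).add r5).add r6).sub r7).add r8).add r9).add r10))
  simp only [pow_one, toGal_apply, add_zero, sub_zero] at key
  convert! key using 1
  noncomm_ring

/-- Any `x, y` with leading coefficients `a, b` and `t = 1` cancel the degree `2` term by the choice
of `a, b`. Thereafter the error in degree `n + 3` is removed by changing `x, y` in degree `n + 2`
and `t` in degree `n + 3`, which leaves `a` and `b` intact. -/
theorem IsMonomialPair.exists_approx_commutator [TopologicalSpace D] [IsModuleTopology F D]
    [Algebra.IsCentral F D] {ζ : ringOfIntegers F D} {γ : (ResidueField F D)ˣ} {r : ℕ}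
    (hM : IsMonomialPair F ϖ ζ γ r) {p : ℕ} [Fact p.Prime] [CharP (ResidueField F D) p]
    (hps : ¬ p ∣ fixedDegree (residueConj F hM.isUniformizer.ne_zero))
    {a b : ResidueField F D} (ha : a ≠ 0) (hb : b ≠ 0)
    (hab : ∀ K : Subfield (ResidueField F D), a / b ∈ K → K = ⊤) {g : D}
    (hg : HasLeadingCoeff F ϖ 2 (g - 1) (a * residueConj F hM.isUniformizer.ne_zero b -
      b * residueConj F hM.isUniformizer.ne_zero a)) (n : ℕ) :
    ∃ (x y : D) (t : F), HasLeadingCoeff F ϖ 1 (x - 1) a ∧ HasLeadingCoeff F ϖ 1 (y - 1) b ∧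
      normValuation F (algebraMap F D t - 1) ≤ normValuation F ϖ ^ 2 ∧
      normValuation F (x * y * algebraMap F D t - g * y * x) ≤ normValuation F ϖ ^ (n + 3) := by
  have hϖ := hM.isUniformizer
  induction n with
  | zero =>
    obtain ⟨x, hx⟩ := exists_hasLeadingCoeff ϖ 1 a
    obtain ⟨y, hy⟩ := exists_hasLeadingCoeff ϖ 1 b
    have hlt : ∀ {x : D} {a}, HasLeadingCoeff F ϖ 1 x a → normValuation F (1 + x - 1) < 1 :=
      fun h => hϖ.lt_one_iff.2 (by simpa using hϖ.le_pow h)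
    refine ⟨1 + x, 1 + y, 1, by rwa [add_sub_cancel_left], by rwa [add_sub_cancel_left],
      by simp, ?_⟩
    have h1 := (hϖ.hasLeadingCoeff_mul hx hy one_add_one_eq_two).sub
      (hϖ.hasLeadingCoeff_mul hy hx one_add_one_eq_two)
    have h2 := hϖ.hasLeadingCoeff_mul hg (hϖ.hasLeadingCoeff_mul
      (hasLeadingCoeff_one (ϖ := ϖ) (hlt hy)) (hasLeadingCoeff_one (ϖ := ϖ) (hlt hx)) (zero_add 0))
      (add_zero 2)
    have h3 := h1.sub h2
    simp only [pow_one, toGal_apply, map_one, mul_one, sub_self] at h3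
    rw [map_one, ← hϖ.hasLeadingCoeff_zero_iff]
    convert! h3 using 1
    noncomm_ring
  | succ n ih =>
    obtain ⟨x, y, t, hx, hy, ht, hE⟩ := ih
    obtain ⟨e, he⟩ := hϖ.exists_hasLeadingCoeff_of_le hE
    obtain ⟨u, v, h, hh, hhs, heq⟩ := exists_residue_correction hps ha hb hab (n + 2) (-e)
    obtain ⟨δ, hδ⟩ := exists_hasLeadingCoeff ϖ (n + 2) u
    obtain ⟨ε, hε⟩ := exists_hasLeadingCoeff ϖ (n + 2) v
    obtain ⟨τ, hτ⟩ : ∃ τ : F, HasLeadingCoeff F ϖ (n + 2 + 1) (algebraMap F D τ) h := by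
      rcases hhs with rfl | ⟨m, hm⟩
      · exact ⟨0, 0, by simp, map_zero _⟩
      · obtain ⟨τ, w, hw, hτ⟩ := hM.exists_central_lift m hh
        exact ⟨τ, w, by rw [hτ, hm], hw⟩
    have hδ1 := hϖ.hasLeadingCoeff_zero_of_lt (n := 1) (by omega) (hϖ.le_pow hδ)
    have hε1 := hϖ.hasLeadingCoeff_zero_of_lt (n := 1) (by omega) (hϖ.le_pow hε)
    refine ⟨x + δ, y + ε, t + τ, ?_, ?_, ?_, ?_⟩
    · have h1 := hx.add hδ1
      rwa [add_zero, sub_add_eq_add_sub] at h1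
    · have h1 := hy.add hε1
      rwa [add_zero, sub_add_eq_add_sub] at h1
    · rw [map_add, ← sub_add_eq_add_sub]
      exact (normValuation F).map_add_le ht
        ((hϖ.le_pow hτ).trans (hϖ.normValuation_pow_le (by omega)))
    · have h1 := hϖ.hasLeadingCoeff_perturbation (by omega) hx hy ht
        (hϖ.le_pow hg) hδ hε hτ he
      rw [heq, add_neg_cancel, ← map_add, hϖ.hasLeadingCoeff_zero_iff] at h1
      exact h1

theorem IsMonomialPair.exists_commutator_mul_algebraMap_eq [TopologicalSpace D]
    [IsModuleTopology F D] [Algebra.IsCentral F D] {ζ : ringOfIntegers F D}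
    {γ : (ResidueField F D)ˣ} {r : ℕ}
    (hM : IsMonomialPair F ϖ ζ γ r) {p : ℕ} [Fact p.Prime] [CharP (ResidueField F D) p]
    (hs : 5 ≤ fixedDegree (residueConj F hM.isUniformizer.ne_zero))
    (hps : ¬ p ∣ fixedDegree (residueConj F hM.isUniformizer.ne_zero))
    {α : ResidueField F D} (hα : α ≠ 0) {g : D} (hg : HasLeadingCoeff F ϖ 2 (g - 1) α) :
    ∃ (x y : D) (t : F), normValuation F (x - 1) < 1 ∧ normValuation F (y - 1) < 1 ∧
      normValuation F (algebraMap F D t - 1) < 1 ∧ x * y * algebraMap F D t = g * y * x := by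
  have hϖ := hM.isUniformizer
  have := isTopologicalRing F D
  have := t2Space F D
  have := t2Space_base F
  obtain ⟨a, b, ha, hb, rfl, hab⟩ := exists_residue_pair hs hps hα
  have happrox := hM.exists_approx_commutator hps ha hb hab hg
  have hcF : Continuous (algebraMap F D) :=
    IsModuleTopology.continuous_of_linearMap (Algebra.linearMap F D)
  have hcl : ∀ (f : D × D × F → D) (_ : Continuous f) (δ : ValueGroupWithZero F),
      IsClosed {z | normValuation F (f z) ≤ δ} := fun f hf δ =>
    (isClosed_setOf_normValuation_le F D δ).preimage hf
  let X : Set (D × D × F) := (ringOfIntegers F D : Set D) ×ˢ (ringOfIntegers F D : Set D) ×ˢ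
    {t : F | valuation F t ≤ 1}
  have hX : IsCompact X := (isCompact_ringOfIntegers F D).prod
    ((isCompact_ringOfIntegers F D).prod (IsNonarchimedeanLocalField.isCompact_closedBall F 1))
  let Y : Set (D × D × F) := X ∩ ({z | normValuation F (z.1 - 1) ≤ normValuation F ϖ} ∩
    ({z | normValuation F (z.2.1 - 1) ≤ normValuation F ϖ} ∩
      {z | normValuation F (algebraMap F D z.2.2 - 1) ≤ normValuation F ϖ}))
  have hY : IsCompact Y := hX.inter_right ((hcl (fun z => z.1 - 1) (by fun_prop) _).inter
    ((hcl (fun z => z.2.1 - 1) (by fun_prop) _).inter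
      (hcl (fun z => algebraMap F D z.2.2 - 1) (by fun_prop) _)))
  let C : ℕ → Set (D × D × F) := fun n => Y ∩ {z | normValuation F
    (z.1 * z.2.1 * algebraMap F D z.2.2 - g * z.2.1 * z.1) ≤ normValuation F ϖ ^ n}
  have hC : ∀ n, IsClosed {z : D × D × F | normValuation F
      (z.1 * z.2.1 * algebraMap F D z.2.2 - g * z.2.1 * z.1) ≤ normValuation F ϖ ^ n} := fun n =>
    hcl (fun z => z.1 * z.2.1 * algebraMap F D z.2.2 - g * z.2.1 * z.1) (by fun_prop) _
  have hint : ∀ {x : D}, normValuation F (x - 1) ≤ normValuation F ϖ → normValuation F x ≤ 1 :=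
    fun h => (normValuation_eq_one_of_sub_one_lt (hϖ.lt_one_iff.2 h)).le
  obtain ⟨⟨x, y, t⟩, hz⟩ := IsCompact.nonempty_iInter_of_sequence_nonempty_isCompact_isClosed C
    (fun n z hz => ⟨hz.1, le_trans (Set.mem_ofPred_eq ▸ hz.2)
      (hϖ.normValuation_pow_le n.le_succ)⟩)
    (fun n => by
      obtain ⟨x, y, t, hx, hy, ht, hE⟩ := happrox n
      have hx' : normValuation F (x - 1) ≤ normValuation F ϖ := by simpa using hϖ.le_pow hx
      have hy' : normValuation F (y - 1) ≤ normValuation F ϖ := by simpa using hϖ.le_pow hy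
      have ht' : normValuation F (algebraMap F D t - 1) ≤ normValuation F ϖ := by
        simpa using ht.trans (hϖ.normValuation_pow_le one_le_two)
      exact ⟨(x, y, t), ⟨⟨hint hx', hint hy', (normValuation_algebraMap_le_one F).1 (hint ht')⟩,
        hx', hy', ht'⟩, hE.trans (hϖ.normValuation_pow_le (by omega))⟩)
    (hY.inter_right (hC 0)) (fun n => hY.isClosed.inter (hC n))
  rw [Set.mem_iInter] at hz
  exact ⟨x, y, t, hϖ.lt_one_iff.2 (hz 0).1.2.1, hϖ.lt_one_iff.2 (hz 0).1.2.2.1,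
    hϖ.lt_one_iff.2 (hz 0).1.2.2.2,
    sub_eq_zero.1 (hϖ.eq_zero_of_forall_le_pow fun n => (hz n).2)⟩

end Commutators

/-! ### The Frattini subgroup, extraction of the `p`-th root, and the two statements -/

section Frattini

variable {F D : Type*} [Field F] [ValuativeRel F] [TopologicalSpace F]
  [IsNonarchimedeanLocalField F] [DivisionRing D] [Algebra F D] [FiniteDimensional F D]
  {ϖ : D}

theorem IsUniformizer.hasLeadingCoeff_mul_sub_one [Finite (ResidueField F D)]
    (hϖ : IsUniformizer F ϖ) {n : ℕ} (hn : 1 ≤ n) {x y : D} {a b : ResidueField F D}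
    (hx : HasLeadingCoeff F ϖ n (x - 1) a) (hy : HasLeadingCoeff F ϖ n (y - 1) b) :
    HasLeadingCoeff F ϖ n (x * y - 1) (a + b) := by
  have h1 := hϖ.hasLeadingCoeff_zero_of_lt (n := n) (m := n + n) (by omega)
    (normValuation_mul_le_pow (hϖ.le_pow hx) (hϖ.le_pow hy))
  have h2 := (hx.add hy).add h1
  rw [add_zero] at h2
  convert! h2 using 1
  noncomm_ring

theorem IsUniformizer.hasLeadingCoeff_pow_sub_one [Finite (ResidueField F D)]
    (hϖ : IsUniformizer F ϖ) {n : ℕ} (hn : 1 ≤ n) {x : D} {a : ResidueField F D}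
    (hx : HasLeadingCoeff F ϖ n (x - 1) a) (j : ℕ) :
    HasLeadingCoeff F ϖ n (x ^ j - 1) (j * a) := by
  induction j with
  | zero => exact ⟨0, by simp, by simp⟩
  | succ j ih =>
    rw [pow_succ, Nat.cast_add, Nat.cast_one, add_mul, one_mul]
    exact hϖ.hasLeadingCoeff_mul_sub_one hn ih hx

theorem frattini_subset [TopologicalSpace D] {p : ℕ} {S : Subgroup Dˣ} (hS : IsClosed (S : Set Dˣ))
    (h1 : ∀ x ∈ congruenceSubgroup F ϖ 1, ∀ y ∈ congruenceSubgroup F ϖ 1, x * y * x⁻¹ * y⁻¹ ∈ S)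
    (h2 : ∀ z ∈ congruenceSubgroup F ϖ 1, z ^ p ∈ S) : frattini F ϖ p ⊆ S := by
  refine closure_minimal ((Subgroup.closure_le S).2 ?_) hS
  rintro g (⟨x, hx, y, hy, rfl⟩ | ⟨z, hz, rfl⟩)
  · exact h1 x hx y hy
  · exact h2 z hz

/-- With `p * i + N * j = 1` the root is `t ^ i * w ^ j`. Its residue has `p`-th power `1`, so it is
`1` in characteristic `p`. -/
theorem exists_pow_eq_of_pow_eq_pow {p : ℕ} [Fact p.Prime] [Finite (ResidueField F D)]
    [CharP (ResidueField F D) p] {N : ℕ} (hN : p.Coprime N) {t w : F} (hw : valuation F w = 1)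
    (ht : normValuation F (algebraMap F D t - 1) < 1) (h : t ^ N = w ^ p) :
    ∃ z : F, z ^ p = t ∧ normValuation F (algebraMap F D z - 1) < 1 := by
  have hp : p.Prime := Fact.out
  have ht1 : valuation F t = 1 := by
    have h1 := normValuation_eq_one_of_sub_one_lt ht
    rw [normValuation_algebraMap] at h1
    exact (pow_eq_one_iff_of_nonneg zero_le Module.finrank_pos.ne').1 h1
  have ht0 : t ≠ 0 := by
    rintro rfl
    rw [map_zero] at ht1
    exact zero_ne_one ht1
  have hw0 : w ≠ 0 := by
    rintro rfl
    rw [map_zero] at hw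
    exact zero_ne_one hw
  set i := p.gcdA N
  set j := p.gcdB N
  have hij : (1 : ℤ) = p * i + N * j := by
    have := Nat.gcd_eq_gcd_ab p N
    rwa [hN.gcd_eq_one, Nat.cast_one] at this
  have hz : (t ^ i * w ^ j) ^ p = t := by
    calc (t ^ i * w ^ j) ^ p = t ^ ((p : ℤ) * i) * (w ^ p) ^ j := by
          rw [mul_pow, ← zpow_natCast, ← zpow_mul, mul_comm i, ← zpow_natCast (w ^ j),
            ← zpow_natCast w, ← zpow_mul, ← zpow_mul, mul_comm j]
      _ = t ^ ((p : ℤ) * i + N * j) := by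
          rw [← h, ← zpow_natCast t, ← zpow_mul, ← zpow_add₀ ht0]
      _ = t := by rw [← hij, zpow_one]
  refine ⟨_, hz, ?_⟩
  set z := t ^ i * w ^ j
  have hz1 : normValuation F (algebraMap F D z) ≤ 1 := by
    rw [normValuation_algebraMap_le_one, map_mul, map_zpow₀, map_zpow₀, ht1, hw, one_zpow, one_zpow,
      one_mul]
  let u : ringOfIntegers F D := ⟨algebraMap F D z, hz1⟩
  have hu : residue F D u ^ p = 1 := by
    rw [← map_pow, ← map_one (residue F D), residue_eq_iff]
    simpa [u, ← map_pow, hz] using ht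
  have hu1 : residue F D u = 1 := by
    have h2 : (residue F D u - 1) ^ p = 0 := by rw [sub_pow_char, hu, one_pow, sub_self]
    exact sub_eq_zero.1 ((pow_eq_zero_iff hp.ne_zero).1 h2)
  rw [← map_one (residue F D), residue_eq_iff] at hu1
  exact hu1

variable [TopologicalSpace D] [IsModuleTopology F D]

theorem IsUniformizer.exists_hasLeadingCoeff_of_mem_frattini [Finite (ResidueField F D)]
    (hϖ : IsUniformizer F ϖ) {p : ℕ} [CharP (ResidueField F D) p] {g : Dˣ}
    (hg : g ∈ frattini F ϖ p) : ∃ α, HasLeadingCoeff F ϖ 2 ((g : D) - 1) α := by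
  have := isTopologicalRing F D
  have hlt : ∀ {x : D}, normValuation F (x - 1) ≤ normValuation F ϖ ^ 2 →
      normValuation F (x - 1) < 1 := fun h =>
    h.trans_lt (pow_lt_one₀ zero_le hϖ.normValuation_lt_one two_ne_zero)
  let S : Subgroup Dˣ :=
    { carrier := {g | normValuation F ((g : D) - 1) ≤ normValuation F ϖ ^ 2}
      one_mem' := by simp
      mul_mem' := fun {x y} hx hy => by
        obtain ⟨a, ha⟩ := hϖ.exists_hasLeadingCoeff_of_le hx
        obtain ⟨b, hb⟩ := hϖ.exists_hasLeadingCoeff_of_le hy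
        exact hϖ.le_pow (hϖ.hasLeadingCoeff_mul_sub_one one_le_two ha hb)
      inv_mem' := fun {x} hx => by
        have h1 : ((x⁻¹ : Dˣ) : D) - 1 = -(((x⁻¹ : Dˣ) : D) * ((x : D) - 1)) := by
          rw [mul_sub, Units.inv_mul, mul_one, neg_sub]
        have h2 := normValuation_eq_one_of_sub_one_lt (hlt hx)
        change normValuation F (((x⁻¹ : Dˣ) : D) - 1) ≤ normValuation F ϖ ^ 2
        rw [h1, Valuation.map_neg, map_mul, Units.val_inv_eq_inv_val, map_inv₀, h2, inv_one,
          one_mul]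
        exact hx }
  have hS : IsClosed (S : Set Dˣ) := IsClosed.preimage (f := fun g : Dˣ => (g : D) - 1)
    (Units.continuous_val.sub continuous_const)
    (isClosed_setOf_normValuation_le F D (normValuation F ϖ ^ 2))
  have hlc : ∀ x ∈ congruenceSubgroup F ϖ 1, ∃ a, HasLeadingCoeff F ϖ 1 ((x : D) - 1) a :=
    fun x hx => hϖ.exists_hasLeadingCoeff_of_le (hϖ.mem_congruenceSubgroup_iff.1 hx)
  refine hϖ.exists_hasLeadingCoeff_of_le (frattini_subset hS (fun x hx y hy => ?_)
    (fun z hz => ?_) hg)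
  · obtain ⟨a, ha⟩ := hlc x hx
    obtain ⟨b, hb⟩ := hlc y hy
    have h1 := hϖ.le_pow (hϖ.hasLeadingCoeff_commutator ha hb)
    change normValuation F (((x * y * x⁻¹ * y⁻¹ : Dˣ) : D) - 1) ≤ normValuation F ϖ ^ 2
    simpa using h1
  · obtain ⟨a, ha⟩ := hlc z hz
    have h1 := hϖ.hasLeadingCoeff_pow_sub_one le_rfl ha p
    rw [CharP.cast_eq_zero, zero_mul, hϖ.hasLeadingCoeff_zero_iff] at h1
    change normValuation F (((z ^ p : Dˣ) : D) - 1) ≤ normValuation F ϖ ^ 2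
    rw [Units.val_pow_eq_pow_val]
    exact h1

/-- Commutators have norm `1` and `p`-th powers have norms that are `p`-th powers. The condition
survives the closure because the `p`-th powers of units of `F` form a compact set. -/
theorem IsUniformizer.exists_norm_eq_pow_of_mem_frattini (hϖ : IsUniformizer F ϖ) {p : ℕ}
    {g : Dˣ} (hg : g ∈ frattini F ϖ p) :
    ∃ w : F, valuation F w = 1 ∧ Algebra.norm F (g : D) = w ^ p := by
  have := t2Space_base F
  have h1 : ∀ x ∈ congruenceSubgroup F ϖ 1, valuation F (Algebra.norm F (x : D)) = 1 :=
    fun x hx => normValuation_eq_one_of_sub_one_lt (hϖ.mem_congruenceSubgroup_one_iff.1 hx)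
  let S : Subgroup Dˣ :=
    { carrier := {g | ∃ w : F, valuation F w = 1 ∧ Algebra.norm F (g : D) = w ^ p}
      one_mem' := ⟨1, map_one _, by simp⟩
      mul_mem' := by
        rintro x y ⟨v, hv, hx⟩ ⟨w, hw, hy⟩
        exact ⟨v * w, by rw [map_mul, hv, hw, one_mul],
          by rw [Units.val_mul, map_mul, hx, hy, mul_pow]⟩
      inv_mem' := by
        rintro x ⟨v, hv, hx⟩
        refine ⟨v⁻¹, by rw [map_inv₀, hv, inv_one], ?_⟩
        have h2 : Algebra.norm F (((x⁻¹ : Dˣ)) : D) * Algebra.norm F (x : D) = 1 := by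
          rw [← map_mul, Units.inv_mul, map_one]
        rw [inv_pow, ← hx]
        exact eq_inv_of_mul_eq_one_left h2 }
  have hK : IsCompact ((fun w : F => w ^ p) '' {w | valuation F w = 1}) := by
    have h2 : {w : F | valuation F w = 1} = {w | valuation F w ≤ 1} ∩ {w | valuation F w < 1}ᶜ := by
      ext w
      simp [le_antisymm_iff]
    rw [h2]
    exact ((IsNonarchimedeanLocalField.isCompact_closedBall F 1).inter_right
      (isOpen_setOf_valuation_lt F one_ne_zero).isClosed_compl).image (continuous_pow p)
  have hS : IsClosed (S : Set Dˣ) := by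
    convert! IsClosed.preimage (f := fun g : Dˣ => Algebra.norm F (g : D))
      ((continuous_norm F D).comp Units.continuous_val) hK.isClosed using 1
    ext g
    constructor
    · rintro ⟨w, hw, hg⟩
      exact ⟨w, hw, hg.symm⟩
    · rintro ⟨w, hw, hg⟩
      exact ⟨w, hw, hg.symm⟩
  refine frattini_subset hS (fun x hx y hy => ⟨1, map_one _, ?_⟩) (fun z hz => ⟨_, h1 z hz, ?_⟩) hg
  · have h2 : ∀ x : Dˣ, Algebra.norm F (x : D) * Algebra.norm F ((x⁻¹ : Dˣ) : D) = 1 := fun x => by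
      rw [← map_mul, Units.mul_inv, map_one]
    simp only [Units.val_mul, map_mul]
    rw [mul_right_comm (Algebra.norm F (x : D)), h2, one_mul, h2, one_pow]
  · rw [Units.val_pow_eq_pow_val, map_pow]

theorem IsUniformizer.exists_commutator_mul_pow_eq [Algebra.IsCentral F D]
    [Finite (ResidueField F D)] (hϖ : IsUniformizer F ϖ) {p d : ℕ} [Fact p.Prime]
    [CharP (ResidueField F D) p] (hdim : Module.finrank F D = d ^ 2) (hd : 4 < d)
    (hp : p.Coprime d) {g : Dˣ} (hg : g ∈ frattini F ϖ p) (hg3 : g ∉ congruenceSubgroup F ϖ 3) :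
    ∃ x ∈ congruenceSubgroup F ϖ 1, ∃ y ∈ congruenceSubgroup F ϖ 1,
      ∃ z ∈ congruenceSubgroup F ϖ 1, g = (x * y * x⁻¹ * y⁻¹) * z ^ p := by
  -- The groups `I_i`, hence the Frattini subgroup, do not depend on the uniformizer, so a monomial
  -- one may be used.
  obtain ⟨ϖ', ζ, γ, r, hM⟩ := hϖ.exists_isMonomialPair
  have hϖ' := hM.isUniformizer
  have hI := hϖ.congruenceSubgroup_eq hϖ'
  have hΦ : frattini F ϖ p = frattini F ϖ' p := by simp only [frattini, hI]
  rw [hΦ] at hg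
  rw [hI] at hg3 ⊢
  obtain ⟨hs, hps⟩ := hϖ'.le_fixedDegree_and_not_dvd hdim hp
  obtain ⟨α, hα⟩ := hϖ'.exists_hasLeadingCoeff_of_mem_frattini hg
  have hα0 : α ≠ 0 := by
    rintro rfl
    exact hg3 (hϖ'.mem_congruenceSubgroup_iff.2 (hϖ'.hasLeadingCoeff_zero_iff.1 hα))
  obtain ⟨x, y, t, hx, hy, ht, heq⟩ :=
    hM.exists_commutator_mul_algebraMap_eq (by omega) hps hα0 hα
  have hx0 := ne_zero_of_sub_one_lt hx
  have hy0 := ne_zero_of_sub_one_lt hy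
  have hg1 : (g : D) = x * y * x⁻¹ * y⁻¹ * algebraMap F D t := by
    rw [mul_assoc (x * y), mul_assoc (x * y), ← Algebra.commutes, ← mul_assoc, ← mul_inv_rev, heq,
      mul_assoc (g : D), mul_inv_cancel_right₀ (mul_ne_zero hy0 hx0)]
  obtain ⟨w, hw, hgw⟩ := hϖ'.exists_norm_eq_pow_of_mem_frattini hg
  have hnorm : t ^ d ^ 2 = w ^ p := by
    have h2 : ∀ x : D, x ≠ 0 → Algebra.norm F x * Algebra.norm F x⁻¹ = 1 := fun x hx => by
      rw [← map_mul, mul_inv_cancel₀ hx, map_one]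
    rw [← hgw, hg1]
    simp only [map_mul]
    rw [mul_right_comm (Algebra.norm F x), h2 x hx0, one_mul, h2 y hy0, one_mul,
      Algebra.norm_algebraMap, hdim]
  obtain ⟨z, hzt, hz⟩ := exists_pow_eq_of_pow_eq_pow (D := D) (hp.pow_right 2) hw ht hnorm
  have hz0 := ne_zero_of_sub_one_lt hz
  refine ⟨Units.mk0 x hx0, hϖ'.mem_congruenceSubgroup_one_iff.2 hx, Units.mk0 y hy0,
    hϖ'.mem_congruenceSubgroup_one_iff.2 hy, Units.mk0 (algebraMap F D z) hz0,
    hϖ'.mem_congruenceSubgroup_one_iff.2 hz, Units.ext ?_⟩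
  simp [hg1, ← hzt]

theorem IsUniformizer.exists_teichmuller_commutator [Algebra.IsCentral F D]
    [Finite (ResidueField F D)] (hϖ : IsUniformizer F ϖ) {p d : ℕ} [Fact p.Prime]
    [CharP (ResidueField F D) p] (hdim : Module.finrank F D = d ^ 2) (hd : 4 < d)
    (hp : p.Coprime d) {τ : ResidueField F D →*₀ ringOfIntegers F D} (hτ : IsTeichmullerLift τ)
    {α : ResidueField F D} (hα : α ≠ 0) :
    ∃ (a b : ResidueField F D) (x y : Dˣ),
      (x : D) = 1 + (τ a : D) * ϖ ∧ x ≠ 1 ∧ (y : D) = 1 + (τ b : D) * ϖ ∧ y ≠ 1 ∧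
      LeadingCoeffEq F ϖ 2 (x * y * x⁻¹ * y⁻¹) α ∧
      ∀ K : Subfield (ResidueField F D), a / b ∈ K → K = ⊤ := by
  obtain ⟨hs, hps⟩ := hϖ.le_fixedDegree_and_not_dvd hdim hp
  obtain ⟨a, b, ha, hb, h, hK⟩ := exists_residue_pair (by omega) hps hα
  have hlc : ∀ c, HasLeadingCoeff F ϖ 1 (1 + (τ c : D) * ϖ - 1) c := fun c =>
    ⟨τ c, by rw [add_sub_cancel_left, pow_one], hτ c⟩
  have hlt : ∀ c, normValuation F (1 + (τ c : D) * ϖ - 1) < 1 := fun c =>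
    hϖ.lt_one_iff.2 (by simpa using hϖ.le_pow (hlc c))
  have hne : ∀ c (hc : 1 + (τ c : D) * ϖ ≠ 0), c ≠ 0 → Units.mk0 _ hc ≠ 1 := by
    intro c hc hc0 h1
    have h2 : 1 + (τ c : D) * ϖ = 1 := congrArg Units.val h1
    rw [add_eq_left, mul_eq_zero, or_iff_left hϖ.ne_zero] at h2
    apply hc0
    rw [← hτ c, show τ c = 0 from Subtype.ext h2, map_zero]
  refine ⟨a, b, Units.mk0 _ (ne_zero_of_sub_one_lt (hlt a)),
    Units.mk0 _ (ne_zero_of_sub_one_lt (hlt b)), rfl, hne a _ ha, rfl, hne b _ hb, ?_, hK⟩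
  rw [leadingCoeffEq_iff, ← h]
  simpa using hϖ.hasLeadingCoeff_commutator (hlc a) (hlc b)

end Frattini

end LocalDivisionAlgebra

end

theorem mainTheorem7 (p : ℕ) [Fact p.Prime]
    (F : Type*) [Field F] [ValuativeRel F] [TopologicalSpace F] [IsNonarchimedeanLocalField F]
    [CharP 𝓀[F] p]
    (D : Type*) [DivisionRing D] [Algebra F D] [FiniteDimensional F D] [Algebra.IsCentral F D]
    [TopologicalSpace D] [IsModuleTopology F D]
    (d : ℕ) (hdim : Module.finrank F D = d ^ 2) (hd : 4 < d)
    (hp : (CharZero F ∧ ∃ e : ℕ, Ideal.span {(p : 𝒪[F])} = 𝓂[F] ^ e ∧ d * e + 1 < p) ∨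
      (CharP F p ∧ p.Coprime d))
    (ϖ : D) (hϖ : LocalDivisionAlgebra.IsUniformizer F ϖ) :
    (∀ τ : LocalDivisionAlgebra.ResidueField F D →*₀ LocalDivisionAlgebra.ringOfIntegers F D,
      LocalDivisionAlgebra.IsTeichmullerLift τ →
      ∀ α : LocalDivisionAlgebra.ResidueField F D, α ≠ 0 →
        ∃ (a b : LocalDivisionAlgebra.ResidueField F D) (x y : Dˣ),
          (x : D) = 1 + (τ a : D) * ϖ ∧ x ≠ 1 ∧ (y : D) = 1 + (τ b : D) * ϖ ∧ y ≠ 1 ∧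
          LocalDivisionAlgebra.LeadingCoeffEq F ϖ 2 (x * y * x⁻¹ * y⁻¹) α ∧
          ∀ K : Subfield (LocalDivisionAlgebra.ResidueField F D), a / b ∈ K → K = ⊤) ∧
    ∀ g ∈ LocalDivisionAlgebra.frattini F ϖ p, g ∉ LocalDivisionAlgebra.congruenceSubgroup F ϖ 3 →
      ∃ x ∈ LocalDivisionAlgebra.congruenceSubgroup F ϖ 1,
      ∃ y ∈ LocalDivisionAlgebra.congruenceSubgroup F ϖ 1,
      ∃ z ∈ LocalDivisionAlgebra.congruenceSubgroup F ϖ 1, g = (x * y * x⁻¹ * y⁻¹) * z ^ p := by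
  have := LocalDivisionAlgebra.finite_residueField F D
  have := LocalDivisionAlgebra.charP_residueField F D p
  have hcop : p.Coprime d := by
    rcases hp with ⟨-, e, he, hlt⟩ | ⟨-, h⟩
    -- As `p` is not a unit of `𝒪[F]`, `e ≥ 1`; then `d ≤ d * e < p` makes `p` prime to `d`.
    · have he0 : e ≠ 0 := by
        rintro rfl
        rw [pow_zero, Ideal.one_eq_top, Ideal.span_singleton_eq_top] at he
        have h1 := he.map (IsLocalRing.residue 𝒪[F])
        rw [map_natCast, CharP.cast_eq_zero] at h1
        exact not_isUnit_zero h1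
      have h1 : d ≤ d * e := Nat.le_mul_of_pos_right d (Nat.pos_of_ne_zero he0)
      exact Nat.coprime_of_lt_prime (by omega) (by omega) Fact.out
    · exact h
  exact ⟨fun τ hτ α hα => hϖ.exists_teichmuller_commutator hdim hd hcop hτ hα,
    fun g hg hg3 => hϖ.exists_commutator_mul_pow_eq hdim hd hcop hg hg3⟩
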